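/- Let $D=D([0,\infty),\mathbb R)$ be the space of right-continuous functions $x:[0,\infty)\to\mathbb R$ with left limits, with the Skorohod $J_1$ topology and its Borel $\sigma$-field, and let $\|x\|_T=\sup_{0\le t\le T}|x(t)|$. Let $\{X_n:n\ge1\}$ be a sequence of random elements of $D$, where $X_n$ is defined on a probability space $(\Omega_n,P_n)$ that may depend on $n$. A sequence of random elements is tight if the set of its laws is tight, i.e. for every $\epsilon>0$ there is a compact set $K$ with $P_n(X_n\in K)>1-\epsilon$ for all $n$. The sequence $\{X_n\}$ is stochastically bounded in $D$ if the sequence of real random variables $\{\|X_n\|_T:n\ge1\}$ is tight for each $T>0$. **Lemma (simple sufficient criterion for tightness).** The following conditions are sufficient, but not necessary, for $\{X_n:n\ge1\}$ to be tight in $D$: (i) $\{X_n:n\ge1\}$ is stochastically bounded in $D$; and either (ii.a) for each $n$, $X_n$ is adapted to a filtration $\{\mathcal F_{n,t}:t\ge0\}$, and for each infinitely differentiable, compactly supported $f:\mathbb R\to\mathbb R$ and each $T>0$ there are nonnegative random variables $Z_n(\delta,f,T)$, $n\ge1$, $\delta>0$, with $$\bigl|E[f(X_n(t+u))-f(X_n(t))\mid\mathcal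 F_{n,t}]\bigr|\le E[Z_n(\delta,f,T)\mid\mathcal F_{n,t}]\quad\text{a.s.}$$ for all $n\ge1$, $\delta>0$, $0\le t\le T$, $0\le u\le\delta$, and $$\lim_{\delta\downarrow0}\limsup_{n\to\infty}E[Z_n(\delta,f,T)]=0;$$ or (ii.b) for each $n$, $X_n$ is adapted to a filtration $\{\mathcal F_{n,t}:t\ge0\}$, and for each $T>0$ there are nonnegative random variables $Z_n(\delta,T)$, $n\ge1$, $\delta>0$, with $$E[(X_n(t+u)-X_n(t))^2\mid\mathcal F_{n,t}]\le E[Z_n(\delta,T)\mid\mathcal F_{n,t}]\quad\text{a.s.}$$ for all $n\ge1$, $\delta>0$, $0\le t\le T$, $0\le u\le\delta$, and $$\lim_{\delta\downarrow0}\limsup_{n\to\infty}E[Z_n(\delta,T)]=0.$$ (Expectations and conditional expectations of nonnegative variables are taken in $[0,\infty]$.) "Not necessary" means: on any sequence of probability spaces there is a tight sequence $\{X_n\}$ of random elements of $D$ that satisfies neither (ii.a) nor (ii.b). -/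

import Mathlib

open MeasureTheory ProbabilityTheory Filter Topology
open scoped NNReal ENNReal Uniformity SetRel

/-- The space `D = D([0,∞), ℝ)`: right-continuous real functions on `[0,∞)` with limits from the
left. (At `t = 0` the left-limit condition is void, because `𝓝[<] (0 : ℝ≥0) = ⊥`.) -/
structure SkorokhodD where
  toFun : ℝ≥0 → ℝ
  right_continuous : ∀ t, ContinuousWithinAt toFun (Set.Ici t) t
  left_limit : ∀ t, ∃ l : ℝ, Tendsto toFun (𝓝[<] t) (𝓝 l)

namespace SkorokhodD

instance : CoeFun SkorokhodD (fun _ => ℝ≥0 → ℝ) := ⟨SkorokhodD.toFun⟩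

/-- Pairs `(x, y)` for which some time change `lam` (an increasing bijection of `[0,∞)`) satisfies
`|lam t - t| ≤ ε` and `|y (lam t) - x t| ≤ ε` for all `t ∈ [0,T]`. -/
def entourage (T ε : ℝ≥0) : Set (SkorokhodD × SkorokhodD) :=
  {p | ∃ lam : ℝ≥0 ≃o ℝ≥0, ∀ t ≤ T, dist (lam t) t ≤ ε ∧ dist (p.2 (lam t)) (p.1 t) ≤ ε}

theorem entourage_mono {T T' ε ε' : ℝ≥0} (hT : T' ≤ T) (hε : ε ≤ ε') :
    entourage T ε ⊆ entourage T' ε' := by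
  rintro p ⟨lam, h⟩
  have hε' : (ε : ℝ) ≤ ε' := by exact_mod_cast hε
  exact ⟨lam, fun t ht => ⟨(h t (ht.trans hT)).1.trans hε', (h t (ht.trans hT)).2.trans hε'⟩⟩

theorem mem_entourage_self (T ε : ℝ≥0) (x : SkorokhodD) : (x, x) ∈ entourage T ε :=
  ⟨OrderIso.refl _, fun t _ => by simp⟩

theorem entourage_symm (T ε : ℝ≥0) : entourage (T + ε) ε ⊆ Prod.swap ⁻¹' entourage T ε := by
  rintro ⟨x, y⟩ ⟨lam, h⟩
  refine ⟨lam.symm, fun s hs => ?_⟩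
  have hle : lam.symm s ≤ T + ε := by
    rw [OrderIso.symm_apply_le]
    refine hs.trans ?_
    have h1 := (abs_le.1 ((NNReal.dist_eq _ _).symm.trans_le (h (T + ε) le_rfl).1)).1
    rw [← NNReal.coe_le_coe]
    push_cast at h1
    linarith
  have h2 := h _ hle
  rw [OrderIso.apply_symm_apply] at h2
  exact ⟨by rw [dist_comm]; exact h2.1, by rw [dist_comm]; exact h2.2⟩

theorem entourage_comp (T ε : ℝ≥0) :
    (entourage (T + ε) (ε / 2) : SetRel SkorokhodD SkorokhodD) ○ entourage (T + ε) (ε / 2)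
      ⊆ entourage T ε := by
  rintro ⟨x, z⟩ ⟨y, ⟨lam, hl⟩, ⟨mu, hm⟩⟩
  refine ⟨lam.trans mu, fun t ht => ?_⟩
  have h1 := hl t (ht.trans le_self_add)
  have hle : lam t ≤ T + ε := by
    have h3 := (abs_le.1 ((NNReal.dist_eq _ _).symm.trans_le h1.1)).2
    have h4 : (t : ℝ) ≤ T := by exact_mod_cast ht
    have h5 : (0 : ℝ) ≤ ε := ε.2
    rw [← NNReal.coe_le_coe]
    push_cast at h3 ⊢
    linarith
  have h2 := hm _ hle
  push_cast at h1 h2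
  simp only [OrderIso.trans_apply] at h1 h2 ⊢
  constructor
  · have := dist_triangle (mu (lam t)) (lam t) t
    linarith [h1.1, h2.1]
  · have := dist_triangle (z (mu (lam t))) (y (lam t)) (x t)
    linarith [h1.2, h2.2]

/-- The filter basis of all `entourage T ε` with `ε > 0`. -/
def entourageBasis : FilterBasis (SkorokhodD × SkorokhodD) where
  sets := {V | ∃ T ε : ℝ≥0, 0 < ε ∧ V = entourage T ε}
  nonempty := ⟨entourage 0 1, 0, 1, one_pos, rfl⟩
  inter_sets := by
    rintro _ _ ⟨T, ε, hε, rfl⟩ ⟨T', ε', hε', rfl⟩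
    exact ⟨entourage (max T T') (min ε ε'), ⟨_, _, lt_min hε hε', rfl⟩,
      Set.subset_inter (entourage_mono (le_max_left _ _) (min_le_left _ _))
        (entourage_mono (le_max_right _ _) (min_le_right _ _))⟩

/-- A (countably generated) uniform structure on `D` that induces the Skorokhod `J₁` topology;
see `tendsto_nhds_iff` for the convergence that it describes. -/
instance : UniformSpace SkorokhodD :=
  .ofCore <| .mkOfBasis entourageBasis
    (by rintro _ ⟨T, ε, -, rfl⟩ x; exact mem_entourage_self T ε x)
    (by rintro _ ⟨T, ε, hε, rfl⟩; exact ⟨_, ⟨_, _, hε, rfl⟩, entourage_symm T ε⟩)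
    (by rintro _ ⟨T, ε, hε, rfl⟩; exact ⟨_, ⟨_, _, half_pos hε, rfl⟩, entourage_comp T ε⟩)

theorem hasBasis_uniformity :
    (𝓤 SkorokhodD).HasBasis (fun p : ℝ≥0 × ℝ≥0 => 0 < p.2) (fun p => entourage p.1 p.2) := by
  refine ⟨fun s => (entourageBasis.hasBasis.mem_iff).trans ?_⟩
  constructor
  · rintro ⟨_, ⟨T, ε, hε, rfl⟩, h⟩
    exact ⟨(T, ε), hε, h⟩
  · rintro ⟨⟨T, ε⟩, hε, h⟩
    exact ⟨_, ⟨T, ε, hε, rfl⟩, h⟩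

/-- Convergence in `D` is convergence in the Skorokhod `J₁` topology: `y i → x` iff there are time
changes that converge to the identity, and carry `y i` to functions that converge to `x`,
uniformly on bounded intervals. -/
theorem tendsto_nhds_iff {ι : Type*} {l : Filter ι} {y : ι → SkorokhodD} {x : SkorokhodD} :
    Tendsto y l (𝓝 x) ↔ ∀ T ε : ℝ≥0, 0 < ε → ∀ᶠ i in l, ∃ lam : ℝ≥0 ≃o ℝ≥0,
      ∀ t ≤ T, dist (lam t) t ≤ ε ∧ dist (y i (lam t)) (x t) ≤ ε := by
  rw [(nhds_basis_uniformity' hasBasis_uniformity).tendsto_right_iff]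
  exact ⟨fun h T ε hε => h (T, ε) hε, fun h p hp => h p.1 p.2 hp⟩

/-- Random elements of `D` are measurable with respect to the Borel σ-field. -/
instance : MeasurableSpace SkorokhodD := borel SkorokhodD

instance : BorelSpace SkorokhodD := ⟨rfl⟩

/-- Elements of `D` are bounded on bounded intervals, so that `supNorm` is a supremum of a
nonempty bounded set. -/
theorem bddAbove_abs (x : SkorokhodD) (T : ℝ≥0) :
    BddAbove (Set.range fun t : Set.Icc (0 : ℝ≥0) T => |x t|) := by
  suffices h : ∃ C, ∀ t ∈ Set.Icc (0 : ℝ≥0) T, |x t| ≤ C by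
    obtain ⟨C, hC⟩ := h
    exact ⟨C, by rintro _ ⟨t, rfl⟩; exact hC t t.2⟩
  refine isCompact_Icc.induction_on (p := fun s => ∃ C, ∀ t ∈ s, |x t| ≤ C)
    ⟨0, by simp⟩ (fun s t hst ⟨C, hC⟩ => ⟨C, fun r hr => hC r (hst hr)⟩) ?_ ?_
  · rintro s t ⟨C, hC⟩ ⟨C', hC'⟩
    refine ⟨max C C', fun r hr => ?_⟩
    rcases hr with hr | hr
    · exact (hC r hr).trans (le_max_left _ _)
    · exact (hC' r hr).trans (le_max_right _ _)
  · intro t _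
    obtain ⟨l, hl⟩ := x.left_limit t
    have h1 : ∀ᶠ s in 𝓝[<] t, |x s| ≤ |l| + 1 :=
      (hl.abs.eventually_lt_const (lt_add_one |l|)).mono fun _ h => h.le
    have h2 : ∀ᶠ s in 𝓝[≥] t, |x s| ≤ |x t| + 1 :=
      ((x.right_continuous t).abs.eventually_lt_const (lt_add_one |x t|)).mono fun _ h => h.le
    have h3 : ∀ᶠ s in 𝓝 t, |x s| ≤ max (|l| + 1) (|x t| + 1) := by
      rw [← nhdsLT_sup_nhdsGE, eventually_sup]
      exact ⟨h1.mono fun _ h => h.trans (le_max_left _ _),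
        h2.mono fun _ h => h.trans (le_max_right _ _)⟩
    exact ⟨_, nhdsWithin_le_nhds h3, _, fun _ h => h⟩

/-- `‖x‖_T = sup_{0 ≤ t ≤ T} |x t|`. -/
noncomputable def supNorm (x : SkorokhodD) (T : ℝ≥0) : ℝ :=
  ⨆ t : Set.Icc (0 : ℝ≥0) T, |x t|

end SkorokhodD

section Criteria

variable {Ω : ℕ → Type*} [mΩ : ∀ n, MeasurableSpace (Ω n)]

/-- A sequence of random elements of `S`, the `n`-th one defined on `(Ω n, P n)`, is tight if the
set of their laws is tight. -/
def TightSequence {S : Type*} [TopologicalSpace S] [MeasurableSpace S]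
    (P : ∀ n, Measure (Ω n)) (X : ∀ n, Ω n → S) : Prop :=
  IsTightMeasureSet (Set.range fun n => (P n).map (X n))

/-- A sequence of random elements of `D` is stochastically bounded in `D` if, for each `T > 0`,
the sequence of real random variables `‖X n‖_T` is tight. -/
def StochasticallyBoundedInD (P : ∀ n, Measure (Ω n)) (X : ∀ n, Ω n → SkorokhodD) : Prop :=
  ∀ T : ℝ≥0, 0 < T → TightSequence P (fun n ω => (X n ω).supNorm T)

/-- The conditional increments of `f (X n)`, for every smooth compactly supported `f`, are
controlled by nonnegative random variables `Z n δ`, which may depend on `f` and `T`. Conditional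
and unconditional expectations of `Z n δ` are taken in `[0,∞]`. -/
def TestFunctionCriterion (P : ∀ n, Measure (Ω n)) (X : ∀ n, Ω n → SkorokhodD) : Prop :=
  ∃ F : ∀ n, Filtration ℝ≥0 (mΩ n),
    (∀ n, Adapted (F n) (fun t ω => X n ω t)) ∧
    ∀ f : ℝ → ℝ, ContDiff ℝ ((⊤ : ℕ∞) : WithTop ℕ∞) f → HasCompactSupport f → ∀ T : ℝ≥0, 0 < T →
      ∃ Z : ∀ n, ℝ≥0 → Ω n → ℝ≥0,
        (∀ n, ∀ δ > 0, Measurable (Z n δ)) ∧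
        (∀ n, ∀ δ > 0, ∀ t ≤ T, ∀ u ≤ δ, ∀ᵐ ω ∂(P n),
          ENNReal.ofReal |((P n)[fun ω' => f (X n ω' (t + u)) - f (X n ω' t) | F n t]) ω|
            ≤ ((P n)⁻[fun ω' => (Z n δ ω' : ℝ≥0∞) | F n t]) ω) ∧
        Tendsto (fun δ : ℝ≥0 => limsup (fun n => ∫⁻ ω, (Z n δ ω : ℝ≥0∞) ∂(P n)) atTop)
          (𝓝[>] 0) (𝓝 0)

/-- The conditional second moments of the increments of `X n` are controlled by nonnegative
random variables `Z n δ`, which may depend on `T`. All expectations are taken in `[0,∞]`. -/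
def SecondMomentCriterion (P : ∀ n, Measure (Ω n)) (X : ∀ n, Ω n → SkorokhodD) : Prop :=
  ∃ F : ∀ n, Filtration ℝ≥0 (mΩ n),
    (∀ n, Adapted (F n) (fun t ω => X n ω t)) ∧
    ∀ T : ℝ≥0, 0 < T →
      ∃ Z : ∀ n, ℝ≥0 → Ω n → ℝ≥0,
        (∀ n, ∀ δ > 0, Measurable (Z n δ)) ∧
        (∀ n, ∀ δ > 0, ∀ t ≤ T, ∀ u ≤ δ, ∀ᵐ ω ∂(P n),
          ((P n)⁻[fun ω' => ENNReal.ofReal ((X n ω' (t + u) - X n ω' t) ^ 2) | F n t]) ω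
            ≤ ((P n)⁻[fun ω' => (Z n δ ω' : ℝ≥0∞) | F n t]) ω) ∧
        Tendsto (fun δ : ℝ≥0 => limsup (fun n => ∫⁻ ω, (Z n δ ω : ℝ≥0∞) ∂(P n)) atTop)
          (𝓝[>] 0) (𝓝 0)

end Criteria

/-! Compactness in `D` has an Arzelà–Ascoli form: a set of paths has compact closure if, for every
j, its paths are uniformly bounded on [0, j] and [0, j) can be cut into intervals of length at least
δ j > 0 on which each path oscillates by at most 1/(j+1) (`isCompact_closure_boundedPartitioned`).
Tightness is thus reduced to bounds and partitions that hold with high probability, uniformly in n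
(`tightSequence_of_bounded_of_hasPartitionOn`). Asymptotic bounds in n suffice, because each single
random path has partitions with high probability.

Partitions come from exit times, as in Aldous' criterion: a path sampled on a grid is cut whenever
it has moved by ε since the last cut. An exit within time d of the previous cut forces a large
increment from one of two successive stopping times up to a common later time, so the conditional
second moment bound, summed over the values of these stopping times, gives it probability at most 4
E[Z] / ε² (`measure_shortExit_le`). A union bound over exits needs control of their number. If q
exits occur by time N and q d₀ = 2N, then at least half of them are short on the coarse scale d₀;
this has probability at most 8 E[Z₀] / ε², whatever q is. The coarse scale fixes q, and a fine scale
then makes q · 4 E[Z₁] small (`measure_iUnion_shortExit_le`). The bounds do not depend on the mesh,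
and right-continuity carries partitions from dyadic grids to all times.

Criterion (ii.a) yields second moment bounds through (W - V)² = W² - V² - 2V(W - V), applied to f(X)
with the test functions f and f², where f is the identity on a large interval. Neither criterion is
necessary: the deterministic unit jump at time 1 is tight as a constant sequence, but its increment
from 1 - δ to 1 is always 1. -/

/-! ### Partitions of paths with small oscillation -/

/-- `[0, T)` is covered by intervals `[t i, t (i + 1))` of length at least `δ` on each of which
`x`, restricted to `S`, oscillates by at most `ε`. -/
def HasPartitionOn (S : Set ℝ≥0) (x : ℝ≥0 → ℝ) (T δ : ℝ≥0) (ε : ℝ) : Prop :=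
  ∃ t : ℕ → ℝ≥0, t 0 = 0 ∧ (∀ i, t i + δ ≤ t (i + 1)) ∧ (∀ i, t i ≤ T + i * δ) ∧
    ∀ i, ∀ s ∈ S, ∀ s' ∈ S, s ∈ Set.Ico (t i) (t (i + 1)) → s' ∈ Set.Ico (t i) (t (i + 1)) →
      s < T → s' < T → |x s - x s'| ≤ ε

namespace HasPartitionOn

variable {S : Set ℝ≥0} {x : ℝ≥0 → ℝ} {T δ : ℝ≥0} {ε : ℝ}

/-- It is enough to control the lengths of the intervals that start before `T`. -/
theorem of_gap_of_lt (t : ℕ → ℝ≥0) (h0 : t 0 = 0) (hgap : ∀ i, t i < T → t i + δ ≤ t (i + 1))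
    (hosc : ∀ i, ∀ s ∈ S, ∀ s' ∈ S, s ∈ Set.Ico (t i) (t (i + 1)) →
      s' ∈ Set.Ico (t i) (t (i + 1)) → s < T → s' < T → |x s - x s'| ≤ ε) :
    HasPartitionOn S x T δ ε := by
  -- Points before T are kept, the first later one is capped at T + δ, and from then on the steps
  -- are exactly δ. This gives the bound T + i δ, which keeps each partition point in a compact
  -- interval when limits of partitions are taken.
  obtain ⟨r, hr0, hr⟩ : ∃ r : ℕ → ℝ≥0, r 0 = 0 ∧
      ∀ i, r (i + 1) = if r i < T then min (t (i + 1)) (T + δ) else r i + δ :=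
    ⟨fun i => Nat.rec (motive := fun _ => ℝ≥0) 0
      (fun i (r : ℝ≥0) => if r < T then min (t (i + 1)) (T + δ) else r + δ) i, rfl, fun _ => rfl⟩
  have hrt : ∀ i, r i < T → r i = t i := by
    intro i hi
    cases i with
    | zero => rw [hr0, h0]
    | succ i =>
      rw [hr] at hi ⊢
      split_ifs at hi ⊢ with h
      · rcases min_lt_iff.1 hi with h1 | h1
        · exact min_eq_left (h1.le.trans le_self_add)
        · exact absurd h1 (not_lt.2 le_self_add)
      · exact absurd (le_self_add.trans_lt hi) h
  refine ⟨r, hr0, fun i => ?_, fun i => ?_, fun i s hs s' hs' h h' hsT hsT' => ?_⟩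
  · rw [hr]
    split_ifs with h
    · refine le_min ?_ (by gcongr)
      have := hrt i h
      rw [this] at h ⊢
      exact hgap i h
    · exact le_rfl
  · induction i with
    | zero => rw [hr0]; exact zero_le
    | succ i ih =>
      rw [hr]
      push_cast
      split_ifs with h
      · refine (min_le_right _ _).trans ?_
        rw [add_mul, one_mul, ← add_assoc, add_right_comm]
        exact le_self_add
      · rw [add_mul, one_mul, ← add_assoc]
        gcongr
  · have hi : r i < T := h.1.trans_lt hsT
    have h1 := hrt i hi
    have h2 : r (i + 1) ≤ t (i + 1) := by rw [hr, if_pos hi]; exact min_le_left _ _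
    rw [h1] at h h'
    exact hosc i s hs s' hs' ⟨h.1, h.2.trans_le h2⟩ ⟨h'.1, h'.2.trans_le h2⟩ hsT hsT'

theorem mono {δ' T' : ℝ≥0} {ε' : ℝ} (h : HasPartitionOn S x T δ ε) (hT : T' ≤ T) (hδ : δ' ≤ δ)
    (hε : ε ≤ ε') : HasPartitionOn S x T' δ' ε' := by
  obtain ⟨t, h0, h1, -, h3⟩ := h
  exact of_gap_of_lt t h0 (fun i _ => le_trans (by gcongr) (h1 i))
    fun i s hs s' hs' h h' hsT hsT' =>
      (h3 i s hs s' hs' h h' (hsT.trans_le hT) (hsT'.trans_le hT)).trans hε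

theorem congr {y : ℝ≥0 → ℝ} (h : HasPartitionOn S x T δ ε) (hxy : ∀ s < T, x s = y s) :
    HasPartitionOn S y T δ ε := by
  obtain ⟨t, h0, h1, h2, h3⟩ := h
  refine ⟨t, h0, h1, h2, fun i s hs s' hs' h h' hsT hsT' => ?_⟩
  rw [← hxy s hsT, ← hxy s' hsT']
  exact h3 i s hs s' hs' h h' hsT hsT'

end HasPartitionOn

theorem Dense.nhdsWithin_inter_Ioo_neBot {D : Set ℝ≥0} (hd : Dense D) {s v : ℝ≥0} (h : s < v) :
    (𝓝[D ∩ Set.Ioo s v] s).NeBot := by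
  rw [← mem_closure_iff_nhdsWithin_neBot, Set.inter_comm]
  refine closure_minimal (hd.open_subset_closure_inter isOpen_Ioo) isClosed_closure ?_
  rw [closure_Ioo h.ne]
  exact ⟨le_rfl, h.le⟩

/-- A right-continuous function has a partition as soon as it has one, with the same parameters,
on sets that exhaust a dense set. -/
theorem hasPartitionOn_univ_of_frequently {x : ℝ≥0 → ℝ} {T δ : ℝ≥0} {ε : ℝ}
    (hx : ∀ t, ContinuousWithinAt x (Set.Ici t) t) (S : ℕ → Set ℝ≥0) (hS : Monotone S)
    (hd : Dense (⋃ m, S m)) (h : ∃ᶠ m in atTop, HasPartitionOn (S m) x T δ ε) :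
    HasPartitionOn Set.univ x T δ ε := by
  obtain ⟨U, hU, hUh⟩ : ∃ U : Ultrafilter ℕ, (U : Filter ℕ) ≤ atTop ∧
      ∀ᶠ m in (U : Filter ℕ), HasPartitionOn (S m) x T δ ε := by
    have : (atTop ⊓ 𝓟 {m | HasPartitionOn (S m) x T δ ε}).NeBot := frequently_mem_iff_neBot.1 h
    exact ⟨Ultrafilter.of _, (Ultrafilter.of_le _).trans inf_le_left,
      (Ultrafilter.of_le _).trans inf_le_right (mem_principal_self _)⟩
  choose! t h0 h1 h2 h3 using fun m (hm : HasPartitionOn (S m) x T δ ε) => hm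
  have hlim : ∀ i, ∃ r, Tendsto (fun m => t m i) U (𝓝 r) := by
    intro i
    obtain ⟨r, -, hr⟩ := (isCompact_Icc (a := (0 : ℝ≥0)) (b := T + i * δ)).ultrafilter_le_nhds
      (U.map fun m => t m i) (by
        rw [le_principal_iff]
        exact hUh.mono fun m hm => ⟨zero_le, h2 m hm i⟩)
    exact ⟨r, hr⟩
  choose r hr using hlim
  refine ⟨r, ?_, fun i => ?_, fun i => ?_, ?_⟩
  · exact tendsto_nhds_unique (hr 0) (tendsto_const_nhds.congr' (hUh.mono fun m hm => (h0 m hm).symm))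
  · exact le_of_tendsto_of_tendsto ((hr i).add_const δ) (hr (i + 1)) (hUh.mono fun m hm => h1 m hm i)
  · exact le_of_tendsto (hr i) (hUh.mono fun m hm => h2 m hm i)
  · intro i
    -- Only the open interval is accessible: its points eventually lie inside the approximating
    -- intervals, while the endpoint r i may fall on either side. Right-continuity recovers the left
    -- endpoint afterwards.
    have key : ∀ s ∈ ⋃ m, S m, ∀ s' ∈ ⋃ m, S m, s ∈ Set.Ioo (r i) (min (r (i + 1)) T) →
        s' ∈ Set.Ioo (r i) (min (r (i + 1)) T) → |x s - x s'| ≤ ε := by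
      intro s hs s' hs' h h'
      obtain ⟨m₁, hm₁⟩ := Set.mem_iUnion.1 hs
      obtain ⟨m₂, hm₂⟩ := Set.mem_iUnion.1 hs'
      have e : ∀ u ∈ Set.Ioo (r i) (min (r (i + 1)) T), ∀ᶠ m in (U : Filter ℕ),
          u ∈ Set.Ico (t m i) (t m (i + 1)) := fun u hu =>
        ((hr i).eventually_lt_const hu.1).mp
          (((hr (i + 1)).eventually_const_lt (hu.2.trans_le (min_le_left _ _))).mono
            fun m hm hm' => ⟨hm'.le, hm⟩)
      obtain ⟨m, ⟨⟨⟨hm1, hm2⟩, hm3⟩, hm4⟩, hm5⟩ := ((((e s h).and (e s' h')).and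
        (hU (eventually_ge_atTop m₁))).and (hU (eventually_ge_atTop m₂))).and hUh |>.exists
      exact h3 m hm5 i s (hS hm3 hm₁) s' (hS hm4 hm₂) hm1 hm2 (h.2.trans_le (min_le_right _ _))
        (h'.2.trans_le (min_le_right _ _))
    intro s _ s' _ hs hs' hsT hsT'
    have := hd.nhdsWithin_inter_Ioo_neBot (lt_min hs.2 hsT)
    have := hd.nhdsWithin_inter_Ioo_neBot (lt_min hs'.2 hsT')
    have sub : ∀ u, (⋃ m, S m) ∩ Set.Ioo u (min (r (i + 1)) T) ⊆ Set.Ici u :=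
      fun u v hv => hv.2.1.le
    have t1 : Tendsto x (𝓝[(⋃ m, S m) ∩ Set.Ioo s (min (r (i + 1)) T)] s) (𝓝 (x s)) :=
      (hx s).mono_left (nhdsWithin_mono _ (sub s))
    have t2 : Tendsto x (𝓝[(⋃ m, S m) ∩ Set.Ioo s' (min (r (i + 1)) T)] s') (𝓝 (x s')) :=
      (hx s').mono_left (nhdsWithin_mono _ (sub s'))
    refine le_of_tendsto (t1.sub_const (x s')).abs ?_
    filter_upwards [self_mem_nhdsWithin] with u hu
    refine le_of_tendsto (t2.const_sub (x u)).abs ?_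
    filter_upwards [self_mem_nhdsWithin] with u' hu'
    exact key u hu.1 u' hu'.1 ⟨hs.1.trans_lt hu.2.1, hu.2.2⟩ ⟨hs'.1.trans_lt hu'.2.1, hu'.2.2⟩

/-- `[0, u)` can be cut into finitely many intervals on which `x` oscillates by at most `ε`. -/
inductive FinitelyPartitioned (x : ℝ≥0 → ℝ) (ε : ℝ) : ℝ≥0 → Prop
  | zero : FinitelyPartitioned x ε 0
  | step {u v : ℝ≥0} : FinitelyPartitioned x ε u → u < v →
      (∀ s ∈ Set.Ico u v, ∀ s' ∈ Set.Ico u v, |x s - x s'| ≤ ε) → FinitelyPartitioned x ε v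

theorem FinitelyPartitioned.exists_hasPartitionOn {x : ℝ≥0 → ℝ} {ε : ℝ} {u : ℝ≥0}
    (h : FinitelyPartitioned x ε u) : ∃ δ > 0, HasPartitionOn Set.univ x u δ ε := by
  suffices H : ∃ (t : ℕ → ℝ≥0) (n : ℕ) (δ : ℝ≥0), 0 < δ ∧ t 0 = 0 ∧ t n = u ∧
      ∀ i < n, t i + δ ≤ t (i + 1) ∧ ∀ s ∈ Set.Ico (t i) (t (i + 1)),
        ∀ s' ∈ Set.Ico (t i) (t (i + 1)), |x s - x s'| ≤ ε by
    obtain ⟨t, n, δ, hδ, h0, hn, h⟩ := H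
    refine ⟨δ, hδ, .of_gap_of_lt (fun i => if i ≤ n then t i else u) (by simp [h0]) ?_ ?_⟩
    · intro i hi
      have hin : i < n := by
        by_contra hcon
        rcases eq_or_lt_of_le (not_lt.1 hcon) with rfl | hlt
        · simp [hn] at hi
        · simp [not_le.2 hlt] at hi
      simp only [hin.le, Nat.succ_le_of_lt hin, if_true]
      exact (h i hin).1
    · intro i s _ s' _ hs hs' hsu _
      have hin : i < n := by
        by_contra hcon
        rcases eq_or_lt_of_le (not_lt.1 hcon) with rfl | hlt
        · simp [hn] at hs
        · simp only [not_le.2 hlt, if_false] at hs; exact absurd hs.1 (not_le.2 hsu)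
      simp only [hin.le, Nat.succ_le_of_lt hin, if_true] at hs hs'
      exact (h i hin).2 s hs s' hs'
  induction h with
  | zero => exact ⟨fun _ => 0, 0, 1, one_pos, rfl, rfl, fun i hi => absurd hi (Nat.not_lt_zero i)⟩
  | @step u v _ huv hosc ih =>
    obtain ⟨t, n, δ, hδ, h0, hn, h⟩ := ih
    refine ⟨fun i => if i ≤ n then t i else v, n + 1, min δ (v - u),
      lt_min hδ (tsub_pos_of_lt huv), by simp [h0], by simp, fun i hi => ?_⟩
    rcases Nat.lt_succ_iff_lt_or_eq.1 hi with hin | rfl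
    · simp only [hin.le, Nat.succ_le_of_lt hin, if_true]
      exact ⟨le_trans (by gcongr; exact min_le_left _ _) (h i hin).1, (h i hin).2⟩
    · simp only [le_rfl, if_true, Nat.not_succ_le_self, if_false, hn]
      refine ⟨le_trans (b := u + (v - u)) (by gcongr; exact min_le_right _ _) ?_, hosc⟩
      rw [add_tsub_cancel_of_le huv.le]

/-- Take the supremum c of the u ≤ T up to which finitely many pieces suffice. The left limit at c
adds a last piece ending at c, and right-continuity at c would go past c if c < T. -/
theorem exists_hasPartitionOn {x : ℝ≥0 → ℝ} (hx : ∀ t, ContinuousWithinAt x (Set.Ici t) t)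
    (hl : ∀ t, ∃ l : ℝ, Tendsto x (𝓝[<] t) (𝓝 l)) (T : ℝ≥0) {ε : ℝ} (hε : 0 < ε) :
    ∃ δ > 0, HasPartitionOn Set.univ x T δ ε := by
  apply FinitelyPartitioned.exists_hasPartitionOn
  have osc : ∀ {l a b : ℝ}, a ∈ Metric.ball l (ε / 2) → b ∈ Metric.ball l (ε / 2) →
      |a - b| ≤ ε := by
    intro l a b ha hb
    have := dist_triangle_right a b l
    rw [Real.dist_eq] at this
    linarith [Metric.mem_ball.1 ha, Metric.mem_ball.1 hb]
  let A : Set ℝ≥0 := {u | u ≤ T ∧ FinitelyPartitioned x ε u}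
  have hA0 : (0 : ℝ≥0) ∈ A := ⟨zero_le, .zero⟩
  have hAb : BddAbove A := ⟨T, fun u hu => hu.1⟩
  have hlub := isLUB_csSup ⟨0, hA0⟩ hAb
  set c := sSup A with hc
  have hcT : c ≤ T := hlub.2 fun u hu => hu.1
  have hcP : FinitelyPartitioned x ε c := by
    obtain ⟨l, hl⟩ := hl c
    rcases eq_zero_or_pos c with h0 | hpos
    · rw [h0]; exact .zero
    have := hl (Metric.ball_mem_nhds l (half_pos hε))
    obtain ⟨v, hv, hvs⟩ := (mem_nhdsLT_iff_exists_Ioo_subset' hpos).1 this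
    obtain ⟨w, hw, hvw, hwc⟩ := hlub.exists_between hv
    rcases eq_or_lt_of_le hwc with rfl | hwc
    · exact hw.2
    · exact .step hw.2 hwc fun s hs s' hs' =>
        osc (hvs ⟨hvw.trans_le hs.1, hs.2⟩) (hvs ⟨hvw.trans_le hs'.1, hs'.2⟩)
  rcases eq_or_lt_of_le hcT with h | h
  · rw [← h]; exact hcP
  · exfalso
    have := hx c (Metric.ball_mem_nhds _ (half_pos hε))
    obtain ⟨v, hv, hvs⟩ := (mem_nhdsGE_iff_exists_Ico_subset' h).1 this
    have hv' : c < min v T := lt_min hv h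
    have : FinitelyPartitioned x ε (min v T) := .step hcP hv' fun s hs s' hs' =>
      osc (hvs ⟨hs.1, hs.2.trans_le (min_le_left _ _)⟩) (hvs ⟨hs'.1, hs'.2.trans_le (min_le_left _ _)⟩)
    exact absurd (hlub.1 ⟨min_le_right _ _, this⟩) (not_le.2 hv')

namespace SkorokhodD

/-- Functions that are close in the Skorokhod topology have partitions with similar parameters. -/
theorem hasPartitionOn_of_mem_entourage {x y : SkorokhodD} {T δ : ℝ≥0} {ε ε' : ℝ}
    (h : HasPartitionOn Set.univ x (T + δ) δ ε) (hε : ε + 2 * (δ / 3 : ℝ≥0) ≤ ε')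
    (hxy : (y, x) ∈ entourage (T + δ) (δ / 3)) : HasPartitionOn Set.univ y T (δ / 3) ε' := by
  obtain ⟨t, h0, h1, -, h3⟩ := h
  obtain ⟨lam, hlam⟩ := hxy
  have hd : ∀ u ≤ T + δ, (lam u : ℝ) ≤ u + (δ / 3 : ℝ≥0) ∧ (u : ℝ) ≤ lam u + (δ / 3 : ℝ≥0) := by
    intro u hu
    have := abs_le.1 ((NNReal.dist_eq _ _).symm.trans_le (hlam u hu).1)
    constructor <;> linarith [this.1, this.2]
  have hδ3 : ((δ / 3 : ℝ≥0) : ℝ) = (δ : ℝ) / 3 := by push_cast; rfl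
  have hδ0 : (0 : ℝ) ≤ δ := δ.2
  -- The partition is pulled back by the time change. Each end of an interval moves by at most δ/3,
  -- which leaves length δ/3, and the values cost 2 · δ/3 in oscillation.
  refine .of_gap_of_lt (fun i => lam.symm (t i)) ?_ (fun i hi => ?_)
    fun i s _ s' _ hs hs' hsT hsT' => ?_
  · simp only [h0]
    exact lam.symm.map_bot
  · rw [OrderIso.le_symm_apply]
    refine le_trans ?_ (h1 i)
    set u := lam.symm (t i) with hu
    have hut : lam u = t i := lam.apply_symm_apply _
    have hi' : (u : ℝ) < T := by exact_mod_cast hi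
    have e1 := (hd (u + δ / 3) (by
      rw [← NNReal.coe_le_coe]; push_cast; linarith)).1
    have e2 := (hd u (by rw [← NNReal.coe_le_coe]; push_cast; linarith)).2
    rw [← hut, ← NNReal.coe_le_coe]
    push_cast at e1 e2 ⊢
    linarith
  · have cl : ∀ s ∈ Set.Ico (lam.symm (t i)) (lam.symm (t (i + 1))),
        lam s ∈ Set.Ico (t i) (t (i + 1)) := fun s hs =>
      ⟨(lam.symm_apply_le).1 hs.1, (lam.lt_symm_apply).1 hs.2⟩
    have lT : ∀ s < T, lam s < T + δ := by
      intro s hs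
      rcases eq_zero_or_pos δ with h | h
      · have := (hd s (hs.le.trans le_self_add)).1
        rw [← NNReal.coe_lt_coe] at hs ⊢
        simp [h] at this ⊢
        exact lt_of_le_of_lt this hs
      · have := (hd s (hs.le.trans le_self_add)).1
        rw [← NNReal.coe_lt_coe] at hs h ⊢
        push_cast at this h ⊢
        linarith
    have e := h3 i (lam s) trivial (lam s') trivial (cl s hs) (cl s' hs') (lT s hsT) (lT s' hsT')
    have e1 := (hlam s (hsT.le.trans le_self_add)).2
    have e2 := (hlam s' (hsT'.le.trans le_self_add)).2
    rw [Real.dist_eq] at e1 e2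
    simp only at e1 e2
    rw [abs_le] at *
    constructor <;> linarith [e.1, e.2, e1.1, e1.2, e2.1, e2.2]

/-- The closure is Borel, so it serves as a measurable substitute for the set of partitioned paths,
at the price of worse constants only. -/
theorem closure_hasPartitionOn_subset {T δ : ℝ≥0} (hδ : 0 < δ) {ε ε' : ℝ}
    (hε : ε + 2 * (δ / 3 : ℝ≥0) ≤ ε') :
    closure {x : SkorokhodD | HasPartitionOn Set.univ x (T + δ) δ ε} ⊆
      {x | HasPartitionOn Set.univ x T (δ / 3) ε'} := by
  intro y hy
  rw [mem_closure_iff_nhds_basis' (nhds_basis_uniformity' hasBasis_uniformity)] at hy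
  obtain ⟨x, hx, hxs⟩ := hy (T + δ, δ / 3) (by positivity)
  exact hasPartitionOn_of_mem_entourage hxs hε hx

end SkorokhodD

/-! ### Compactness through ultrafilters -/

/-- An ultrafilter U on the closure is moved to K: every open member of U meets K, and these traces
generate a filter on K. A limit of a finer ultrafilter is a limit of U, since regularity allows
testing with closed neighbourhoods only. -/
theorem isCompact_closure_of_ultrafilter_le_nhds {X : Type*} [TopologicalSpace X] [RegularSpace X]
    {K : Set X} (h : ∀ U : Ultrafilter X, K ∈ U → ∃ x, (U : Filter X) ≤ 𝓝 x) :
    IsCompact (closure K) := by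
  rw [isCompact_iff_ultrafilter_le_nhds']
  intro U hU
  let F : Filter X := ⨅ W : {W : Set X // IsOpen W ∧ W ∈ U}, 𝓟 (W.1 ∩ K)
  have hne : ∀ W : {W : Set X // IsOpen W ∧ W ∈ U}, (𝓟 (W.1 ∩ K)).NeBot := by
    intro W
    rw [principal_neBot_iff]
    obtain ⟨z, hz, hz'⟩ := U.nonempty_of_mem (inter_mem W.2.2 hU)
    exact mem_closure_iff.1 hz' _ W.2.1 hz
  have : Nonempty {W : Set X // IsOpen W ∧ W ∈ U} := ⟨⟨Set.univ, isOpen_univ, univ_mem⟩⟩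
  have : F.NeBot := iInf_neBot_of_directed' (fun W W' =>
    ⟨⟨W.1 ∩ W'.1, W.2.1.inter W'.2.1, inter_mem W.2.2 W'.2.2⟩,
      principal_mono.2 (Set.inter_subset_inter_left _ Set.inter_subset_left),
      principal_mono.2 (Set.inter_subset_inter_left _ Set.inter_subset_right)⟩) hne
  have hF : ∀ W, IsOpen W → W ∈ U → W ∩ K ∈ F := fun W hW hWU =>
    mem_iInf_of_mem ⟨W, hW, hWU⟩ (mem_principal_self _)
  obtain ⟨x, hx⟩ := h (Ultrafilter.of F)
    (Ultrafilter.of_le F (mem_of_superset (hF _ isOpen_univ univ_mem) Set.inter_subset_right))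
  have hUx : (U : Filter X) ≤ 𝓝 x := by
    refine (closed_nhds_basis x).ge_iff.2 fun C hC => ?_
    by_contra hCU
    have h1 : Cᶜ ∈ U := Ultrafilter.compl_mem_iff_notMem.2 hCU
    have h2 := Ultrafilter.of_le F (hF _ hC.2.isOpen_compl h1)
    obtain ⟨z, hz, hz'⟩ := (Ultrafilter.of F).nonempty_of_mem (inter_mem h2 (hx hC.1))
    exact hz.1 hz'
  exact ⟨x, isClosed_closure.mem_of_tendsto (f := id) hUx hU, hUx⟩

theorem exists_tendsto_of_forall_exists_abs_sub_le {α : Type*} {l : Filter α} {g : α → ℝ}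
    (h : ∀ ε > 0, ∃ A ∈ l, ∀ a ∈ A, ∀ b ∈ A, |g a - g b| ≤ ε) : ∃ c, Tendsto g l (𝓝 c) := by
  rcases eq_or_neBot l with rfl | hl
  · exact ⟨0, tendsto_bot⟩
  refine cauchy_map_iff_exists_tendsto.1 (Metric.cauchy_iff.2 ⟨inferInstance, fun ε hε => ?_⟩)
  obtain ⟨A, hA, hAg⟩ := h (ε / 2) (half_pos hε)
  refine ⟨g '' A, image_mem_map hA, ?_⟩
  rintro _ ⟨a, ha, rfl⟩ _ ⟨b, hb, rfl⟩
  rw [Real.dist_eq]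
  linarith [hAg a ha b hb]

/-! ### Piecewise linear time changes -/

section Interpolation

variable {t t' : ℕ → ℝ≥0} {δ δ' : ℝ≥0}

theorem nat_mul_le_of_gap (h : ∀ i, t i + δ ≤ t (i + 1)) (i : ℕ) : i * δ ≤ t i := by
  induction i with
  | zero => simp
  | succ i ih =>
    push_cast
    rw [add_mul, one_mul]
    exact (add_le_add_left ih δ).trans (h i)

theorem strictMono_of_gap (hδ : 0 < δ) (h : ∀ i, t i + δ ≤ t (i + 1)) : StrictMono t :=
  strictMono_nat_of_lt_succ fun i => (lt_add_of_pos_right _ hδ).trans_le (h i)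

theorem exists_mem_Ico_of_gap (hδ : 0 < δ) (h0 : t 0 = 0) (h : ∀ i, t i + δ ≤ t (i + 1))
    (s : ℝ≥0) : ∃ i, s ∈ Set.Ico (t i) (t (i + 1)) := by
  have hex : ∃ i, s < t i := by
    obtain ⟨n, hn⟩ := exists_nat_gt (s / δ)
    exact ⟨n, ((div_lt_iff₀ hδ).1 hn).trans_le (nat_mul_le_of_gap h n)⟩
  classical
  have hpos : Nat.find hex ≠ 0 := fun h' => by
    have := Nat.find_spec hex
    rw [h', h0] at this
    exact not_lt_zero this
  obtain ⟨i, hi⟩ := Nat.exists_eq_succ_of_ne_zero hpos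
  refine ⟨i, not_lt.1 (Nat.find_min hex (by omega)), ?_⟩
  have := Nat.find_spec hex
  rwa [hi] at this

/-- The piecewise linear function that maps each `i : ℕ` to `t i`. -/
noncomputable def interpolate (t : ℕ → ℝ≥0) (s : ℝ≥0) : ℝ≥0 :=
  t ⌊s⌋₊ + (s - ⌊s⌋₊) * (t (⌊s⌋₊ + 1) - t ⌊s⌋₊)

theorem interpolate_mem (ht : StrictMono t) (s : ℝ≥0) :
    interpolate t s ∈ Set.Ico (t ⌊s⌋₊) (t (⌊s⌋₊ + 1)) := by
  have h := ht (Nat.lt_succ_self ⌊s⌋₊)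
  refine ⟨le_self_add, ?_⟩
  have h1 : s - ⌊s⌋₊ < 1 := by
    rw [tsub_lt_iff_left (Nat.floor_le zero_le)]
    exact Nat.lt_floor_add_one s
  calc interpolate t s < t ⌊s⌋₊ + 1 * (t (⌊s⌋₊ + 1) - t ⌊s⌋₊) := by
        unfold interpolate
        gcongr
        exact tsub_pos_of_lt h
    _ = t (⌊s⌋₊ + 1) := by rw [one_mul, add_tsub_cancel_of_le h.le]

theorem interpolate_strictMono (ht : StrictMono t) : StrictMono (interpolate t) := by
  intro s s' hss
  rcases eq_or_lt_of_le (Nat.floor_mono hss.le) with h | h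
  · unfold interpolate
    rw [← h]
    have h2 : s - ⌊s⌋₊ < s' - ⌊s⌋₊ := tsub_lt_tsub_right_of_le (Nat.floor_le zero_le) hss
    gcongr
    exact tsub_pos_of_lt (ht (Nat.lt_succ_self _))
  · exact (interpolate_mem ht s).2.trans_le ((ht.monotone h).trans (interpolate_mem ht s').1)

theorem interpolate_surjective (hδ : 0 < δ) (h0 : t 0 = 0) (h : ∀ i, t i + δ ≤ t (i + 1)) :
    Function.Surjective (interpolate t) := by
  intro r
  obtain ⟨i, hi⟩ := exists_mem_Ico_of_gap hδ h0 h r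
  have hlt : t i < t (i + 1) := hi.1.trans_lt hi.2
  have hpos : 0 < t (i + 1) - t i := tsub_pos_of_lt hlt
  have hf : ⌊(i : ℝ≥0) + (r - t i) / (t (i + 1) - t i)⌋₊ = i := by
    rw [Nat.floor_eq_iff zero_le]
    refine ⟨le_self_add, ?_⟩
    gcongr
    rw [div_lt_one hpos]
    exact tsub_lt_tsub_right_of_le hi.1 hi.2
  refine ⟨i + (r - t i) / (t (i + 1) - t i), ?_⟩
  unfold interpolate
  rw [hf, add_tsub_cancel_left, div_mul_cancel₀ _ hpos.ne', add_tsub_cancel_of_le hi.1]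

/-- A time change that carries the intervals `[t i, t (i + 1))` to `[t' i, t' (i + 1))`. -/
theorem exists_orderIso_of_gap (hδ : 0 < δ) (h0 : t 0 = 0) (h : ∀ i, t i + δ ≤ t (i + 1))
    (hδ' : 0 < δ') (h0' : t' 0 = 0) (h' : ∀ i, t' i + δ' ≤ t' (i + 1)) :
    ∃ lam : ℝ≥0 ≃o ℝ≥0, ∀ i, ∀ s ∈ Set.Ico (t i) (t (i + 1)),
      lam s ∈ Set.Ico (t' i) (t' (i + 1)) ∧
      ∀ ε : ℝ, dist (t' i) (t i) ≤ ε → dist (t' (i + 1)) (t (i + 1)) ≤ ε → dist (lam s) s ≤ ε := by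
  have ht := strictMono_of_gap hδ h
  have ht' := strictMono_of_gap hδ' h'
  let e := (interpolate_strictMono ht).orderIsoOfSurjective _ (interpolate_surjective hδ h0 h)
  let e' := (interpolate_strictMono ht').orderIsoOfSurjective _ (interpolate_surjective hδ' h0' h')
  refine ⟨e.symm.trans e', fun i s hs => ?_⟩
  obtain ⟨u, rfl⟩ := e.surjective s
  simp only [OrderIso.trans_apply, OrderIso.symm_apply_apply]
  change interpolate t u ∈ _ at hs
  change interpolate t' u ∈ _ ∧ ∀ ε : ℝ, _ → _ → dist (interpolate t' u) (interpolate t u) ≤ ε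
  have hm := interpolate_mem ht u
  have hi : ⌊u⌋₊ = i := by
    have h1 := ht.lt_iff_lt.1 (hs.1.trans_lt hm.2)
    have h2 := ht.lt_iff_lt.1 (hm.1.trans_lt hs.2)
    omega
  refine ⟨hi ▸ interpolate_mem ht' u, fun ε h1 h2 => ?_⟩
  have hfl : (i : ℝ≥0) ≤ u := hi ▸ Nat.floor_le zero_le
  have hfl' : u ≤ i + 1 := hi ▸ (Nat.lt_floor_add_one u).le
  unfold interpolate
  rw [NNReal.dist_eq, abs_le] at h1 h2 ⊢
  rw [hi]
  push_cast [NNReal.coe_sub hfl, NNReal.coe_sub (ht (Nat.lt_succ_self i)).le,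
    NNReal.coe_sub (ht' (Nat.lt_succ_self i)).le]
  -- The two images are convex combinations of the endpoints with the same weight u - i, so their
  -- difference is a convex combination of the endpoint differences.
  have a1 : (0 : ℝ) ≤ u - i := sub_nonneg.2 (by exact_mod_cast hfl)
  have a2 : (0 : ℝ) ≤ 1 - (u - i) := by
    have : (u : ℝ) ≤ i + 1 := by exact_mod_cast hfl'
    linarith
  constructor
  · nlinarith [mul_le_mul_of_nonneg_left h1.1 a2, mul_le_mul_of_nonneg_left h2.1 a1]
  · nlinarith [mul_le_mul_of_nonneg_left h1.2 a2, mul_le_mul_of_nonneg_left h2.2 a1]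

end Interpolation

/-! ### An Arzelà–Ascoli criterion in `D` -/

namespace SkorokhodD

/-- The set of functions in `D` with prescribed bounds, and prescribed interval lengths for
partitions, on all intervals `[0, j]`. -/
def boundedPartitioned (C : ℕ → ℝ) (δ : ℕ → ℝ≥0) : Set SkorokhodD :=
  {x | ∀ j : ℕ, (∀ s ≤ (j : ℝ≥0), |x s| ≤ C j) ∧
    HasPartitionOn Set.univ x j (δ j) (1 / ((j : ℝ) + 1))}

theorem exists_le_nhds_of_boundedPartitioned_mem {C : ℕ → ℝ} {δ : ℕ → ℝ≥0} (hδ : ∀ j, 0 < δ j)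
    (U : Ultrafilter SkorokhodD) (hU : boundedPartitioned C δ ∈ U) :
    ∃ x, (U : Filter SkorokhodD) ≤ 𝓝 x := by
  have hev : ∀ᶠ y in (U : Filter SkorokhodD), y ∈ boundedPartitioned C δ := hU
  have hg : ∀ s : ℝ≥0, ∃ c, Tendsto (fun y : SkorokhodD => y s) U (𝓝 c) := by
    intro s
    obtain ⟨j, hj⟩ := exists_nat_ge s
    obtain ⟨c, -, hc⟩ := (isCompact_Icc (a := -C j) (b := C j)).ultrafilter_le_nhds
      (U.map fun y => y s) (by
        rw [le_principal_iff]
        exact hev.mono fun y hy => abs_le.1 ((hy j).1 s hj))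
    exact ⟨c, hc⟩
  choose g hg using hg
  choose! t h0 h1 h2 h3 using fun (y : SkorokhodD) (hy : y ∈ boundedPartitioned C δ) (j : ℕ) =>
    (hy j).2
  have hr : ∀ j i, ∃ c, Tendsto (fun y => t y j i) U (𝓝 c) := by
    intro j i
    obtain ⟨r, -, hr⟩ := (isCompact_Icc (a := (0 : ℝ≥0)) (b := j + i * δ j)).ultrafilter_le_nhds
      (U.map fun y => t y j i) (by
        rw [le_principal_iff]
        exact hev.mono fun y hy => ⟨zero_le, h2 y hy j i⟩)
    exact ⟨r, hr⟩
  choose r hr using hr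
  have r0 : ∀ j, r j 0 = 0 := fun j =>
    tendsto_nhds_unique (hr j 0) (tendsto_const_nhds.congr' (hev.mono fun y hy => (h0 y hy j).symm))
  have r1 : ∀ j i, r j i + δ j ≤ r j (i + 1) := fun j i =>
    le_of_tendsto_of_tendsto ((hr j i).add_const _) (hr j (i + 1)) (hev.mono fun y hy => h1 y hy j i)
  have rmem : ∀ j i, ∀ u ∈ Set.Ioo (r j i) (r j (i + 1)), ∀ᶠ y in (U : Filter SkorokhodD),
      u ∈ Set.Ico (t y j i) (t y j (i + 1)) := fun j i u hu =>
    ((hr j i).eventually_lt_const hu.1).mp (((hr j (i + 1)).eventually_const_lt hu.2).mono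
      fun m hm hm' => ⟨hm'.le, hm⟩)
  have gosc : ∀ j i, ∀ s ∈ Set.Ioo (r j i) (r j (i + 1)), ∀ s' ∈ Set.Ioo (r j i) (r j (i + 1)),
      s < j → s' < j → |g s - g s'| ≤ 1 / ((j : ℝ) + 1) := by
    intro j i s hs s' hs' hsj hsj'
    refine le_of_tendsto ((hg s).sub (hg s')).abs ?_
    filter_upwards [hev, rmem j i s hs, rmem j i s' hs'] with y hy hy1 hy2
    exact h3 y hy j i s trivial s' trivial hy1 hy2 hsj hsj'
  have large : ∀ (ε : ℝ) (s : ℝ≥0), 0 < ε → ∃ j : ℕ, s < j ∧ 1 / ((j : ℝ) + 1) < ε := by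
    intro ε s hε
    obtain ⟨n, hn⟩ := exists_nat_one_div_lt hε
    obtain ⟨m, hm⟩ := exists_nat_gt s
    refine ⟨max n m, hm.trans_le (by exact_mod_cast le_max_right n m), lt_of_le_of_lt ?_ hn⟩
    have : (n : ℝ) ≤ (max n m : ℕ) := by exact_mod_cast le_max_left n m
    gcongr
  have idx : ∀ j s, ∃ i, s ∈ Set.Ico (r j i) (r j (i + 1)) := fun j s =>
    exists_mem_Ico_of_gap (hδ j) (r0 j) (r1 j) s
  have gright : ∀ s, ∃ c, Tendsto g (𝓝[>] s) (𝓝 c) := by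
    intro s
    refine exists_tendsto_of_forall_exists_abs_sub_le fun ε hε => ?_
    obtain ⟨j, hj, hjε⟩ := large ε s hε
    obtain ⟨i, hi⟩ := idx j s
    refine ⟨_, Ioo_mem_nhdsGT (lt_min hi.2 hj), fun a ha b hb => ?_⟩
    exact (gosc j i a ⟨hi.1.trans_lt ha.1, ha.2.trans_le (min_le_left _ _)⟩ b
      ⟨hi.1.trans_lt hb.1, hb.2.trans_le (min_le_left _ _)⟩ (ha.2.trans_le (min_le_right _ _))
      (hb.2.trans_le (min_le_right _ _))).trans hjε.le
  -- The pointwise limit g may have wrong values at the limiting partition points r j i, so its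
  -- right limits are taken as the limit path.
  choose x hx using gright
  have gx : ∀ j i, ∀ s ∈ Set.Ioo (r j i) (r j (i + 1)), ∀ s' ∈ Set.Ico (r j i) (r j (i + 1)),
      s < j → s' < j → |g s - x s'| ≤ 1 / ((j : ℝ) + 1) := by
    intro j i s hs s' hs' hsj hsj'
    refine le_of_tendsto ((hx s').const_sub (g s)).abs ?_
    filter_upwards [Ioo_mem_nhdsGT (lt_min hs'.2 hsj')] with a ha
    exact gosc j i s hs a ⟨hs'.1.trans_lt ha.1, ha.2.trans_le (min_le_left _ _)⟩ hsj
      (ha.2.trans_le (min_le_right _ _))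
  have xosc : ∀ j i, ∀ s ∈ Set.Ico (r j i) (r j (i + 1)), ∀ s' ∈ Set.Ico (r j i) (r j (i + 1)),
      s < j → s' < j → |x s - x s'| ≤ 1 / ((j : ℝ) + 1) := by
    intro j i s hs s' hs' hsj hsj'
    refine le_of_tendsto ((hx s).sub_const (x s')).abs ?_
    filter_upwards [Ioo_mem_nhdsGT (lt_min hs.2 hsj)] with a ha
    exact gx j i a ⟨hs.1.trans_lt ha.1, ha.2.trans_le (min_le_left _ _)⟩ s' hs'
      (ha.2.trans_le (min_le_right _ _)) hsj'
  let X : SkorokhodD :=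
    { toFun := x
      right_continuous := by
        intro s
        refine Metric.tendsto_nhds.2 fun ε hε => ?_
        obtain ⟨j, hj, hjε⟩ := large ε s hε
        obtain ⟨i, hi⟩ := idx j s
        filter_upwards [Ico_mem_nhdsGE (lt_min hi.2 hj)] with a ha
        rw [Real.dist_eq]
        exact (xosc j i a ⟨hi.1.trans ha.1, ha.2.trans_le (min_le_left _ _)⟩ s hi
          (ha.2.trans_le (min_le_right _ _)) hj).trans_lt hjε
      left_limit := by
        intro s
        refine exists_tendsto_of_forall_exists_abs_sub_le fun ε hε => ?_
        obtain ⟨j, hj, hjε⟩ := large ε s hε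
        obtain ⟨i, hi⟩ := idx j s
        rcases eq_or_lt_of_le hi.1 with h | h
        · cases i with
          | zero =>
            -- Here s = 0, where the filter of left neighbourhoods is trivial.
            refine ⟨∅, ?_, by simp⟩
            rw [← h, r0 j]
            simp
          | succ i =>
            have hlt := strictMono_of_gap (hδ j) (r1 j) (Nat.lt_succ_self i)
            rw [← h]
            refine ⟨_, Ioo_mem_nhdsLT hlt, fun a ha b hb => ?_⟩
            rw [← h] at hj
            exact (xosc j i a ⟨ha.1.le, ha.2⟩ b ⟨hb.1.le, hb.2⟩ (ha.2.trans hj)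
              (hb.2.trans hj)).trans hjε.le
        · refine ⟨_, Ioo_mem_nhdsLT h, fun a ha b hb => ?_⟩
          exact (xosc j i a ⟨ha.1.le, ha.2.trans hi.2⟩ b ⟨hb.1.le, hb.2.trans hi.2⟩
            (ha.2.trans hj) (hb.2.trans hj)).trans hjε.le }
  refine ⟨X, ?_⟩
  change Tendsto id (U : Filter SkorokhodD) (𝓝 X)
  rw [tendsto_nhds_iff]
  intro T ε hε
  -- The margin ε keeps `lam s` below j for s ≤ T. The value error has three parts, each at most
  -- 1/(j+1) < ε/3: from y (`lam s`) to y (p i), to g (p i), to x s.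
  obtain ⟨j, hj, hjε⟩ := large (ε / 3) (T + ε) (by positivity)
  obtain ⟨n, hn⟩ := exists_nat_gt (T / δ j)
  have hTn : ∀ i, r j i ≤ T → i < n := by
    intro i hi
    have h4 := (nat_mul_le_of_gap (r1 j) i).trans hi
    rw [← le_div_iff₀ (hδ j)] at h4
    exact_mod_cast h4.trans_lt hn
  have hpt : ∀ i, r j i ≤ T → ∃ p, p ∈ Set.Ioo (r j i) (r j (i + 1)) ∧ p < j := by
    intro i hi
    obtain ⟨p, hp⟩ := exists_between (lt_min
      (strictMono_of_gap (hδ j) (r1 j) (Nat.lt_succ_self i)) ((hi.trans le_self_add).trans_lt hj))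
    exact ⟨p, ⟨hp.1, hp.2.trans_le (min_le_left _ _)⟩, hp.2.trans_le (min_le_right _ _)⟩
  choose! p hp hpj using hpt
  -- Intervals meeting [0, T] have index i < n, so their right endpoints have index at most n.
  have hclose : ∀ᶠ y in (U : Filter SkorokhodD), ∀ i ∈ Finset.range (n + 1),
      dist (t y j i) (r j i) ≤ ε :=
    (Finset.eventually_all _).2 fun i _ =>
      (Metric.tendsto_nhds.1 (hr j i) ε (by exact_mod_cast hε)).mono fun y hy => hy.le
  have hval : ∀ᶠ y in (U : Filter SkorokhodD), ∀ i ∈ Finset.range (n + 1), r j i ≤ T →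
      p i ∈ Set.Ico (t y j i) (t y j (i + 1)) ∧ dist (y (p i)) (g (p i)) ≤ 1 / ((j : ℝ) + 1) := by
    refine (Finset.eventually_all _).2 fun i _ => ?_
    by_cases hi : r j i ≤ T
    · filter_upwards [rmem j i _ (hp i hi), Metric.tendsto_nhds.1 (hg (p i))
        (1 / ((j : ℝ) + 1)) (by positivity)] with y hy1 hy2 _
      exact ⟨hy1, hy2.le⟩
    · exact Eventually.of_forall fun y h => absurd h hi
  filter_upwards [hev, hclose, hval] with y hy hyc hyv
  obtain ⟨lam, hlam⟩ := exists_orderIso_of_gap (hδ j) (r0 j) (r1 j) (hδ j) (h0 y hy j) (h1 y hy j)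
  refine ⟨lam, fun s hs => ?_⟩
  obtain ⟨i, hi⟩ := idx j s
  have hiT : r j i ≤ T := hi.1.trans hs
  have hin := hTn i hiT
  obtain ⟨hl1, hl2⟩ := hlam i s hi
  have hd := hl2 ε (hyc i (Finset.mem_range.2 (by omega)))
    (hyc (i + 1) (Finset.mem_range.2 (by omega)))
  refine ⟨hd, ?_⟩
  have hls : lam s < j := by
    refine lt_of_le_of_lt ?_ hj
    have h5 := (abs_le.1 ((NNReal.dist_eq _ _).symm.trans_le hd)).2
    have h6 : (s : ℝ) ≤ T := by exact_mod_cast hs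
    rw [← NNReal.coe_le_coe]
    push_cast
    linarith
  obtain ⟨hv1, hv2⟩ := hyv i (Finset.mem_range.2 (by omega)) hiT
  have b1 := h3 y hy j i (lam s) trivial (p i) trivial hl1 hv1 hls (hpj i hiT)
  have b2 := gx j i (p i) (hp i hiT) s hi (hpj i hiT) ((hs.trans le_self_add).trans_lt hj)
  rw [Real.dist_eq] at hv2 ⊢
  change |y (lam s) - x s| ≤ ε
  rw [abs_le] at *
  constructor <;> linarith [b1.1, b1.2, b2.1, b2.2, hv2.1, hv2.2]

theorem isCompact_closure_boundedPartitioned {C : ℕ → ℝ} {δ : ℕ → ℝ≥0} (hδ : ∀ j, 0 < δ j) :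
    IsCompact (closure (boundedPartitioned C δ)) :=
  isCompact_closure_of_ultrafilter_le_nhds (exists_le_nhds_of_boundedPartitioned_mem hδ)

end SkorokhodD

/-! ### Exit times of a sequence -/

section ExitTimes

/-- The first time after `k` at which `y` is at distance at least `ε` from `y k`, if `k ≤ N` and
if this happens before time `k + M`, and `k + M` otherwise. -/
noncomputable def nextExit (ε : ℝ) (N M : ℕ) (y : ℕ → ℝ) (k : ℕ) : ℕ :=
  sInf {l | k < l ∧ ((k ≤ N ∧ ε ≤ |y l - y k|) ∨ k + M ≤ l)}

/-- The iterates of `nextExit`, starting from time `0`. -/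
noncomputable def exitTime (ε : ℝ) (N M : ℕ) (y : ℕ → ℝ) : ℕ → ℕ
  | 0 => 0
  | i + 1 => nextExit ε N M y (exitTime ε N M y i)

variable {ε : ℝ} {N M : ℕ} {y : ℕ → ℝ}

theorem nextExit_mem (hM : 0 < M) (k : ℕ) :
    k < nextExit ε N M y k ∧ ((k ≤ N ∧ ε ≤ |y (nextExit ε N M y k) - y k|) ∨
      k + M ≤ nextExit ε N M y k) :=
  Nat.sInf_mem (s := {l | k < l ∧ ((k ≤ N ∧ ε ≤ |y l - y k|) ∨ k + M ≤ l)})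
    ⟨k + M, by omega, Or.inr le_rfl⟩

theorem abs_sub_lt_of_lt_nextExit (hε : 0 < ε) {k l : ℕ} (hk : k ≤ N) (hkl : k ≤ l)
    (hl : l < nextExit ε N M y k) : |y l - y k| < ε := by
  rcases eq_or_lt_of_le hkl with rfl | hlt
  · simpa using hε
  · by_contra h
    exact Nat.notMem_of_lt_sInf hl ⟨hlt, Or.inl ⟨hk, not_lt.1 h⟩⟩

/-- The right-hand side involves y at times up to l and at k only, which makes the exit times
stopping times. -/
theorem nextExit_eq_iff (hM : 0 < M) {k l : ℕ} :
    nextExit ε N M y k = l ↔ (k < l ∧ ((k ≤ N ∧ ε ≤ |y l - y k|) ∨ k + M ≤ l)) ∧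
      ∀ j < l, ¬ (k < j ∧ ((k ≤ N ∧ ε ≤ |y j - y k|) ∨ k + M ≤ j)) := by
  constructor
  · rintro rfl
    exact ⟨nextExit_mem hM k, fun j hj => Nat.notMem_of_lt_sInf hj⟩
  · rintro ⟨h1, h2⟩
    refine le_antisymm (Nat.sInf_le h1) ?_
    by_contra h
    exact h2 _ (not_le.1 h) (nextExit_mem hM k)

theorem exitTime_strictMono (hM : 0 < M) : StrictMono (exitTime ε N M y) :=
  strictMono_nat_of_lt_succ fun _ => (nextExit_mem hM _).1

end ExitTimes

/-! ### Aldous' estimate in discrete time -/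

section Discrete

variable {Ω : Type*} {m0 : MeasurableSpace Ω} {μ : Measure Ω} {G : Filtration ℕ m0}
  {y : ℕ → Ω → ℝ} {ε : ℝ} {N M : ℕ}

theorem measurableSet_nextExit_eq (hM : 0 < M) (hy : ∀ k, Measurable[G k] (y k)) (k l : ℕ) :
    MeasurableSet[G l] {ω | nextExit ε N M (fun k => y k ω) k = l} := by
  simp only [nextExit_eq_iff hM]
  have h : ∀ j ≤ l, MeasurableSet[G l]
      {ω | k < j ∧ ((k ≤ N ∧ ε ≤ |y j ω - y k ω|) ∨ k + M ≤ j)} := by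
    intro j hj
    by_cases hkj : k < j
    · have h1 : Measurable[G l] (y j) := (hy j).mono (G.mono hj) le_rfl
      have h2 : Measurable[G l] (y k) := (hy k).mono (G.mono (hkj.le.trans hj)) le_rfl
      have h3 : MeasurableSet[G l] {ω | ε ≤ |y j ω - y k ω|} := by
        have h4 : Measurable[G l] fun ω => |y j ω - y k ω| :=
          @Measurable.comp Ω ℝ ℝ (G l) _ _ _ _ measurable_norm (h1.sub h2)
        exact h4 measurableSet_Ici
      simp only [hkj, true_and]
      exact (MeasurableSet.inter (MeasurableSet.const _) h3).union (MeasurableSet.const _)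
    · simp [hkj]
  rw [Set.ofPred_and]
  refine (h l le_rfl).inter ?_
  simp only [Set.ofPred_forall]
  exact MeasurableSet.iInter fun j => MeasurableSet.iInter fun hj => (h j hj.le).compl

theorem measurableSet_exitTime_eq (hM : 0 < M) (hy : ∀ k, Measurable[G k] (y k)) (i l : ℕ) :
    MeasurableSet[G l] {ω | exitTime ε N M (fun k => y k ω) i = l} := by
  induction i generalizing l with
  | zero =>
    simp only [exitTime]
    exact MeasurableSet.const _
  | succ i ih =>
    have : {ω | exitTime ε N M (fun k => y k ω) (i + 1) = l} =
        ⋃ k, ⋃ _ : k < l, {ω | exitTime ε N M (fun k => y k ω) i = k} ∩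
          {ω | nextExit ε N M (fun k => y k ω) k = l} := by
      ext ω
      simp only [exitTime, Set.mem_ofPred_eq, Set.mem_iUnion, Set.mem_inter_iff, exists_prop]
      constructor
      · rintro rfl
        exact ⟨_, (nextExit_mem hM _).1, rfl, rfl⟩
      · rintro ⟨k, -, rfl, h⟩
        exact h
    rw [this]
    exact MeasurableSet.iUnion fun k => MeasurableSet.iUnion fun hk =>
      (G.mono hk.le _ (ih k)).inter (measurableSet_nextExit_eq hM hy k l)

theorem measurable_exitTime (hM : 0 < M) (hy : ∀ k, Measurable[G k] (y k)) (i : ℕ) :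
    Measurable fun ω => exitTime ε N M (fun k => y k ω) i :=
  measurable_to_countable' fun l => G.le l _ (measurableSet_exitTime_eq hM hy i l)

/-- The event that the `i`-th exit interval has length at most `d`. -/
def shortExit (ε : ℝ) (N M : ℕ) (y : ℕ → Ω → ℝ) (d i : ℕ) : Set Ω :=
  {ω | exitTime ε N M (fun k => y k ω) (i + 1) ≤ exitTime ε N M (fun k => y k ω) i + d}

theorem measurableSet_shortExit (hM : 0 < M) (hy : ∀ k, Measurable[G k] (y k)) (d i : ℕ) :
    MeasurableSet (shortExit ε N M y d i) :=
  measurableSet_le (measurable_exitTime hM hy (i + 1)) ((measurable_exitTime hM hy i).add_const d)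

theorem sum_setLIntegral_le_lintegral {ι : Type*} [Countable ι] {B : ι → Set Ω}
    (hB : ∀ i, MeasurableSet (B i)) (hd : Pairwise (Function.onFun Disjoint B)) {A : Set Ω}
    (hA : ∀ i, B i ⊆ A) (f : Ω → ℝ≥0∞) :
    ∑' i, ∫⁻ ω in B i, f ω ∂μ ≤ ∫⁻ ω in A, f ω ∂μ := by
  rw [← lintegral_iUnion hB hd]
  exact lintegral_mono_set (Set.iUnion_subset hA)

/-- Aldous' estimate: an exit soon after the `i`-th exit time forces a large increment over a
fixed time either from the `i`-th or from the `(i + 1)`-st exit time. -/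
theorem measure_shortExit_le (hy : ∀ k, Measurable[G k] (y k)) {d : ℕ} (hdM : d < M)
    (hε : 0 < ε) {Z : Ω → ℝ≥0∞}
    (hZ : ∀ k l, k ≤ N + d → k ≤ l → l ≤ k + 2 * d → ∀ A, MeasurableSet[G k] A →
      ∫⁻ ω in A, ENNReal.ofReal ((y l ω - y k ω) ^ 2) ∂μ ≤ ∫⁻ ω in A, Z ω ∂μ) (i : ℕ) :
    ENNReal.ofReal (ε ^ 2) * μ (shortExit ε N M y d i) ≤ 4 * ∫⁻ ω, Z ω ∂μ := by
  have hM : 0 < M := by omega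
  set τ : ℕ → Ω → ℕ := fun i ω => exitTime ε N M (fun k => y k ω) i with hτ
  have hτm : ∀ i l, MeasurableSet[G l] {ω | τ i ω = l} := measurableSet_exitTime_eq hM hy
  have hym : ∀ k, Measurable (y k) := fun k => (hy k).mono (G.le k) le_rfl
  set V : ℕ → ℕ → Ω → ℝ≥0∞ := fun k l ω => ENNReal.ofReal ((y l ω - y k ω) ^ 2) with hV
  have hVm : ∀ k l, Measurable (V k l) := fun k l =>
    (((hym l).sub (hym k)).pow_const 2).ennreal_ofReal
  let B : ℕ → ℕ → Set Ω := fun k l => {ω | τ i ω = k ∧ τ (i + 1) ω = l ∧ l ≤ k + d}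
  have hB : ∀ k l, B k l ⊆ {ω | τ i ω = k} := fun k l ω hω => hω.1
  have hBl : ∀ k l, MeasurableSet[G l] (B k l) := by
    intro k l
    by_cases hkl : k < l
    · exact (G.mono hkl.le _ (hτm i k)).inter ((hτm (i + 1) l).inter (MeasurableSet.const _))
    · have : B k l = ∅ := by
        ext ω
        simp only [B, Set.mem_ofPred_eq, Set.mem_empty_iff_false, iff_false]
        rintro ⟨h1, h2, -⟩
        have := exitTime_strictMono (ε := ε) (N := N) (y := fun k => y k ω) hM (Nat.lt_add_one i)
        simp only [hτ] at h1 h2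
        omega
      rw [this]
      exact @MeasurableSet.empty _ (G l)
  have hBm : ∀ k l, MeasurableSet (B k l) := fun k l => G.le l _ (hBl k l)
  have hBd : ∀ k, Pairwise (Function.onFun Disjoint (B k)) := fun k l l' hll =>
    Set.disjoint_left.2 fun ω h h' => hll (h.2.1.symm.trans h'.2.1)
  have hpt : ∀ k l, ∀ ω ∈ B k l, k < l ∧ k ≤ N ∧
      ENNReal.ofReal (ε ^ 2) ≤ 2 * V l (k + 2 * d) ω + 2 * V k (k + 2 * d) ω := by
    rintro k l ω ⟨h1, h2, h3⟩
    obtain ⟨h4, h5⟩ := nextExit_mem (ε := ε) (N := N) (y := fun k => y k ω) hM (τ i ω)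
    change τ i ω < τ (i + 1) ω at h4
    change (τ i ω ≤ N ∧ ε ≤ |y (τ (i + 1) ω) ω - y (τ i ω) ω|) ∨ τ i ω + M ≤ τ (i + 1) ω at h5
    rw [h1, h2] at h4 h5
    rcases h5 with h5 | h5
    · refine ⟨h4, h5.1, ?_⟩
      simp only [hV]
      rw [← ENNReal.ofReal_ofNat 2, ← ENNReal.ofReal_mul (by norm_num),
        ← ENNReal.ofReal_mul (by norm_num), ← ENNReal.ofReal_add (by positivity) (by positivity)]
      apply ENNReal.ofReal_le_ofReal
      have h6 : ε ^ 2 ≤ (y l ω - y k ω) ^ 2 := by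
        rw [← sq_abs (y l ω - y k ω)]
        exact pow_le_pow_left₀ hε.le h5.2 2
      -- With a and b the increments from l and from k up to k + 2d, (b - a)² = 2a² + 2b² - (a +
      -- b)².
      nlinarith [sq_nonneg ((y (k + 2 * d) ω - y l ω) + (y (k + 2 * d) ω - y k ω))]
    · omega
  have hk : ∀ k, ENNReal.ofReal (ε ^ 2) * μ (⋃ l, B k l) ≤ 4 * ∫⁻ ω in {ω | τ i ω = k}, Z ω ∂μ := by
    intro k
    have hsum : ∀ l, ENNReal.ofReal (ε ^ 2) * μ (B k l) ≤
        2 * ∫⁻ ω in B k l, Z ω ∂μ + 2 * ∫⁻ ω in B k l, V k (k + 2 * d) ω ∂μ := by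
      intro l
      rcases (B k l).eq_empty_or_nonempty with h | ⟨ω₀, hω₀⟩
      · simp [h]
      have hkl := (hpt k l ω₀ hω₀).1
      have hkN := (hpt k l ω₀ hω₀).2.1
      calc ENNReal.ofReal (ε ^ 2) * μ (B k l)
          = ∫⁻ ω in B k l, ENNReal.ofReal (ε ^ 2) ∂μ := by rw [setLIntegral_const]
        _ ≤ ∫⁻ ω in B k l, (2 * V l (k + 2 * d) ω + 2 * V k (k + 2 * d) ω) ∂μ :=
            setLIntegral_mono' (hBm k l) fun ω hω => (hpt k l ω hω).2.2
        _ = 2 * ∫⁻ ω in B k l, V l (k + 2 * d) ω ∂μ +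
              2 * ∫⁻ ω in B k l, V k (k + 2 * d) ω ∂μ := by
            rw [lintegral_add_left ((hVm _ _).const_mul 2), lintegral_const_mul _ (hVm _ _),
              lintegral_const_mul _ (hVm _ _)]
        _ ≤ _ := by
            gcongr 2 * ?_ + _
            exact hZ l (k + 2 * d) (by have := hω₀.2.2; omega) (by have := hω₀.2.2; omega)
              (by omega) _ (hBl k l)
    calc ENNReal.ofReal (ε ^ 2) * μ (⋃ l, B k l)
        = ∑' l, ENNReal.ofReal (ε ^ 2) * μ (B k l) := by
          rw [measure_iUnion (hBd k) (hBm k), ENNReal.tsum_mul_left]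
      _ ≤ ∑' l, (2 * ∫⁻ ω in B k l, Z ω ∂μ + 2 * ∫⁻ ω in B k l, V k (k + 2 * d) ω ∂μ) :=
          ENNReal.tsum_le_tsum hsum
      _ = 2 * ∑' l, ∫⁻ ω in B k l, Z ω ∂μ +
            2 * ∑' l, ∫⁻ ω in B k l, V k (k + 2 * d) ω ∂μ := by
          rw [ENNReal.tsum_add, ENNReal.tsum_mul_left, ENNReal.tsum_mul_left]
      _ ≤ 2 * ∫⁻ ω in {ω | τ i ω = k}, Z ω ∂μ + 2 * ∫⁻ ω in {ω | τ i ω = k}, Z ω ∂μ := by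
          -- `B k l` belongs to `G l` but need not belong to `G k`. The increment from k is
          -- therefore first summed over l and enlarged to the event τ i = k, which is in `G k`.
          rcases le_or_gt k N with hkN | hkN
          · gcongr 2 * ?_ + 2 * ?_
            · exact sum_setLIntegral_le_lintegral (hBm k) (hBd k) (hB k) _
            · exact (sum_setLIntegral_le_lintegral (hBm k) (hBd k) (hB k) _).trans
                (hZ k (k + 2 * d) (by omega) (by omega) le_rfl _ (hτm i k))
          · have : ∀ l, B k l = ∅ := fun l =>
              Set.eq_empty_of_forall_notMem fun ω hω => absurd (hpt k l ω hω).2.1 (not_le.2 hkN)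
            simp [this]
      _ = 4 * ∫⁻ ω in {ω | τ i ω = k}, Z ω ∂μ := by rw [← add_mul]; norm_num
  have hE : shortExit ε N M y d i = ⋃ k, ⋃ l, B k l := by
    ext ω
    simp only [shortExit, B, Set.mem_ofPred_eq, Set.mem_iUnion]
    exact ⟨fun h => ⟨_, _, rfl, rfl, h⟩, by rintro ⟨k, l, rfl, rfl, h⟩; exact h⟩
  have hd : Pairwise (Function.onFun Disjoint fun k => ⋃ l, B k l) := fun k k' hkk =>
    Set.disjoint_left.2 fun ω h h' => by
      obtain ⟨l, hl⟩ := Set.mem_iUnion.1 h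
      obtain ⟨l', hl'⟩ := Set.mem_iUnion.1 h'
      exact hkk (hl.1.symm.trans hl'.1)
  calc ENNReal.ofReal (ε ^ 2) * μ (shortExit ε N M y d i)
      = ∑' k, ENNReal.ofReal (ε ^ 2) * μ (⋃ l, B k l) := by
        rw [hE, measure_iUnion hd fun k => MeasurableSet.iUnion (hBm k), ENNReal.tsum_mul_left]
    _ ≤ ∑' k, 4 * ∫⁻ ω in {ω | τ i ω = k}, Z ω ∂μ := ENNReal.tsum_le_tsum hk
    _ = 4 * ∑' k, ∫⁻ ω in {ω | τ i ω = k}, Z ω ∂μ := ENNReal.tsum_mul_left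
    _ ≤ 4 * ∫⁻ ω, Z ω ∂μ := by
        rw [← setLIntegral_univ (μ := μ) Z]
        gcongr
        exact sum_setLIntegral_le_lintegral (fun k => G.le k _ (hτm i k))
          (fun k k' hkk => Set.disjoint_left.2 fun ω h h' => hkk (h.symm.trans h'))
          (fun k => Set.subset_univ _) _

/-- Each interval counted here advances t by more than d, and the others do not move it back. -/
theorem card_long_mul_le {t : ℕ → ℕ} (ht : Monotone t) (d q : ℕ) :
    ((Finset.range q).filter fun i => ¬ t (i + 1) ≤ t i + d).card * d ≤ t q := by
  induction q with
  | zero => simp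
  | succ q ih =>
    rw [Finset.range_add_one, Finset.filter_insert]
    split_ifs with h
    · exact ih.trans (ht (Nat.le_succ q))
    · rw [Finset.card_insert_of_notMem (by simp), add_mul]
      omega

/-- The probability that some exit interval is short, in terms of the increments on two time
scales: the coarse one bounds the number of exit intervals. -/
theorem measure_iUnion_shortExit_le (hy : ∀ k, Measurable[G k] (y k)) {d₀ d₁ q : ℕ}
    (hd₀M : d₀ < M) (hd : d₁ ≤ d₀) (hd₀ : 0 < d₀) (hq : q * d₀ = 2 * N) (hq0 : 0 < q)
    (hε : 0 < ε) {Z₀ Z₁ : Ω → ℝ≥0∞}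
    (hZ₀ : ∀ k l, k ≤ N + d₀ → k ≤ l → l ≤ k + 2 * d₀ → ∀ A, MeasurableSet[G k] A →
      ∫⁻ ω in A, ENNReal.ofReal ((y l ω - y k ω) ^ 2) ∂μ ≤ ∫⁻ ω in A, Z₀ ω ∂μ)
    (hZ₁ : ∀ k l, k ≤ N + d₁ → k ≤ l → l ≤ k + 2 * d₁ → ∀ A, MeasurableSet[G k] A →
      ∫⁻ ω in A, ENNReal.ofReal ((y l ω - y k ω) ^ 2) ∂μ ≤ ∫⁻ ω in A, Z₁ ω ∂μ) :
    ENNReal.ofReal (ε ^ 2) * μ (⋃ i, shortExit ε N M y d₁ i) ≤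
      8 * ∫⁻ ω, Z₀ ω ∂μ + q * (4 * ∫⁻ ω, Z₁ ω ∂μ) := by
  have hM : 0 < M := by omega
  set τ : ℕ → Ω → ℕ := fun i ω => exitTime ε N M (fun k => y k ω) i with hτ
  have hmono : ∀ ω, Monotone fun i => τ i ω := fun ω => (exitTime_strictMono hM).monotone
  have hsub : (⋃ i, shortExit ε N M y d₁ i) ⊆
      {ω | τ q ω ≤ N} ∪ ⋃ i ∈ Finset.range q, shortExit ε N M y d₁ i := by
    intro ω hω
    obtain ⟨i, hi⟩ := Set.mem_iUnion.1 hω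
    rcases lt_or_ge i q with h | h
    · exact Or.inr (Set.mem_biUnion (Finset.mem_range.2 h) hi)
    -- An interval that starts after N has length at least M > d₁, so a short one with index i ≥ q
    -- forces τ q ≤ τ i ≤ N.
    · left
      change τ (i + 1) ω ≤ τ i ω + d₁ at hi
      have h1 := hmono ω h
      obtain ⟨h4, h5⟩ := nextExit_mem (ε := ε) (N := N) (y := fun k => y k ω) hM (τ i ω)
      change (τ i ω ≤ N ∧ ε ≤ |y (τ (i + 1) ω) ω - y (τ i ω) ω|) ∨ τ i ω + M ≤ τ (i + 1) ω at h5
      change τ q ω ≤ N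
      simp only at h1
      omega
  have hcount : (q : ℝ≥0∞) * μ {ω | τ q ω ≤ N} ≤
      2 * ∑ i ∈ Finset.range q, μ (shortExit ε N M y d₀ i) := by
    have hm : MeasurableSet {ω | τ q ω ≤ N} :=
      measurableSet_le (measurable_exitTime hM hy q) measurable_const
    have hi1 : ∀ i, ∫⁻ ω, (shortExit ε N M y d₀ i).indicator 1 ω ∂μ =
        μ (shortExit ε N M y d₀ i) := fun i => lintegral_indicator_one
          (measurableSet_shortExit hM hy d₀ i)
    have hmi : ∀ i, Measurable ((shortExit ε N M y d₀ i).indicator (1 : Ω → ℝ≥0∞)) := fun i =>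
      measurable_one.indicator (measurableSet_shortExit hM hy d₀ i)
    simp only [← hi1]
    rw [← lintegral_finsetSum _ fun i _ => hmi i, ← lintegral_const_mul _
      (Finset.measurable_fun_sum _ fun i _ => hmi i), ← setLIntegral_const]
    refine (setLIntegral_mono' hm fun ω hω => ?_).trans (setLIntegral_le_lintegral _ _)
    have h1 : ∑ i ∈ Finset.range q, (shortExit ε N M y d₀ i).indicator (1 : Ω → ℝ≥0∞) ω =
        (((Finset.range q).filter fun i => τ (i + 1) ω ≤ τ i ω + d₀).card : ℝ≥0∞) := by
      rw [Finset.card_filter]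
      push_cast
      refine Finset.sum_congr rfl fun i _ => ?_
      simp only [Set.indicator_apply, shortExit, Set.mem_ofPred_eq, Pi.one_apply]
      rfl
    rw [h1]
    have h2 := card_long_mul_le (hmono ω) d₀ q
    have h3 := Finset.card_filter_add_card_filter_not (s := Finset.range q)
      (fun i => τ (i + 1) ω ≤ τ i ω + d₀)
    rw [Finset.card_range] at h3
    have hω' : τ q ω ≤ N := hω
    -- Otherwise more than q/2 intervals are longer than d₀, and together they exceed q d₀ / 2 = N ≥
    -- τ q.
    have h4 : q ≤ 2 * ((Finset.range q).filter fun i => τ (i + 1) ω ≤ τ i ω + d₀).card := by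
      by_contra hcon
      set a := ((Finset.range q).filter fun i => τ (i + 1) ω ≤ τ i ω + d₀).card
      set b := ((Finset.range q).filter fun i => ¬ τ (i + 1) ω ≤ τ i ω + d₀).card
      have h5 : q + 1 ≤ 2 * b := by omega
      nlinarith
    exact_mod_cast h4
  -- The factor q cancels, so the bound is free of q and the fine scale can be chosen after q.
  have hqN : ENNReal.ofReal (ε ^ 2) * μ {ω | τ q ω ≤ N} ≤ 8 * ∫⁻ ω, Z₀ ω ∂μ := by
    rw [← ENNReal.mul_le_mul_iff_right (a := (q : ℝ≥0∞)) (by exact_mod_cast hq0.ne')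
      (ENNReal.natCast_ne_top q)]
    calc (q : ℝ≥0∞) * (ENNReal.ofReal (ε ^ 2) * μ {ω | τ q ω ≤ N})
        = ENNReal.ofReal (ε ^ 2) * (q * μ {ω | τ q ω ≤ N}) := by ring
      _ ≤ ENNReal.ofReal (ε ^ 2) * (2 * ∑ i ∈ Finset.range q, μ (shortExit ε N M y d₀ i)) := by
          gcongr
      _ = 2 * ∑ i ∈ Finset.range q, ENNReal.ofReal (ε ^ 2) * μ (shortExit ε N M y d₀ i) := by
          rw [Finset.mul_sum, Finset.mul_sum, Finset.mul_sum]
          exact Finset.sum_congr rfl fun i _ => by ring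
      _ ≤ 2 * ∑ i ∈ Finset.range q, 4 * ∫⁻ ω, Z₀ ω ∂μ := by
          refine mul_le_mul_right (Finset.sum_le_sum fun i _ => ?_) _
          exact measure_shortExit_le hy hd₀M hε hZ₀ i
      _ = q * (8 * ∫⁻ ω, Z₀ ω ∂μ) := by
          rw [Finset.sum_const, Finset.card_range, nsmul_eq_mul]
          ring
  calc ENNReal.ofReal (ε ^ 2) * μ (⋃ i, shortExit ε N M y d₁ i)
      ≤ ENNReal.ofReal (ε ^ 2) * (μ {ω | τ q ω ≤ N} +
          ∑ i ∈ Finset.range q, μ (shortExit ε N M y d₁ i)) := by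
        gcongr
        exact (measure_mono hsub).trans ((measure_union_le _ _).trans
          (by gcongr; exact measure_biUnion_finset_le _ _))
    _ = ENNReal.ofReal (ε ^ 2) * μ {ω | τ q ω ≤ N} +
          ∑ i ∈ Finset.range q, ENNReal.ofReal (ε ^ 2) * μ (shortExit ε N M y d₁ i) := by
        rw [mul_add, Finset.mul_sum]
    _ ≤ 8 * ∫⁻ ω, Z₀ ω ∂μ + ∑ i ∈ Finset.range q, 4 * ∫⁻ ω, Z₁ ω ∂μ := by
        refine add_le_add hqN (Finset.sum_le_sum fun i _ => ?_)
        exact measure_shortExit_le hy (hd.trans_lt hd₀M) hε hZ₁ i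
    _ = _ := by rw [Finset.sum_const, Finset.card_range, nsmul_eq_mul]

end Discrete

/-! ### From dyadic grids to continuous time -/

/-- The grid of all multiples of `2⁻ᵐ`. -/
def dyadicGrid (m : ℕ) : Set ℝ≥0 := Set.range fun k : ℕ => (k : ℝ≥0) * (1 / 2) ^ m

theorem dyadicGrid_mono : Monotone dyadicGrid := by
  refine monotone_nat_of_le_succ fun m => ?_
  rintro _ ⟨k, rfl⟩
  refine ⟨2 * k, ?_⟩
  push_cast
  rw [pow_succ]
  ring_nf

theorem dense_iUnion_dyadicGrid : Dense (⋃ m, dyadicGrid m) := by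
  refine dense_of_exists_between fun {a b} hab => ?_
  obtain ⟨m, hm⟩ := exists_pow_lt_of_lt_one (tsub_pos_of_lt hab) (NNReal.half_lt_self one_ne_zero)
  have hp : (0 : ℝ≥0) < (1 / 2) ^ m := by positivity
  refine ⟨(⌊a / (1 / 2) ^ m⌋₊ + 1 : ℕ) * (1 / 2) ^ m, Set.mem_iUnion.2 ⟨m, _, rfl⟩, ?_, ?_⟩
  · rw [← div_lt_iff₀ hp]
    exact_mod_cast Nat.lt_floor_add_one _
  · push_cast
    rw [add_mul, one_mul]
    calc (⌊a / (1 / 2) ^ m⌋₊ : ℝ≥0) * (1 / 2) ^ m + (1 / 2) ^ m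
        ≤ a + (1 / 2) ^ m := by
          gcongr
          rw [← le_div_iff₀ hp]
          exact Nat.floor_le zero_le
      _ < a + (b - a) := by gcongr
      _ = b := add_tsub_cancel_of_le hab.le

section Sampling

variable {Ω : Type*} {m0 : MeasurableSpace Ω} {μ : Measure Ω} {F : Filtration ℝ≥0 m0}
  {Y : ℝ≥0 → Ω → ℝ} {ε : ℝ}

theorem two_pow_sub_mul_half_pow {a m : ℕ} (h : a ≤ m) :
    ((2 ^ (m - a) : ℕ) : ℝ≥0) * (1 / 2) ^ m = (1 / 2) ^ a := by
  obtain ⟨c, rfl⟩ := Nat.exists_eq_add_of_le h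
  rw [Nat.add_sub_cancel_left, pow_add, mul_left_comm]
  push_cast
  rw [← mul_pow]
  norm_num

/-- Sampling a process at the multiples of `2⁻ᵐ`: exit intervals that are not short form a
partition. -/
theorem hasPartitionOn_dyadicGrid {x : ℝ≥0 → ℝ} (hε : 0 < ε) (T : ℕ) {b m : ℕ} (hbm : b ≤ m)
    (h : ∀ i, ¬ exitTime ε (T * 2 ^ m) (2 ^ m) (fun k : ℕ => x (k * (1 / 2) ^ m)) (i + 1) ≤
      exitTime ε (T * 2 ^ m) (2 ^ m) (fun k : ℕ => x (k * (1 / 2) ^ m)) i + 2 ^ (m - b)) :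
    HasPartitionOn (dyadicGrid m) x T ((1 / 2) ^ b) (2 * ε) := by
  have hp : (0 : ℝ≥0) < (1 / 2) ^ m := by positivity
  set τ := exitTime ε (T * 2 ^ m) (2 ^ m) (fun k : ℕ => x (k * (1 / 2) ^ m)) with hτ
  refine .of_gap_of_lt (fun i => (τ i : ℝ≥0) * (1 / 2) ^ m) ?_ (fun i _ => ?_) ?_
  · simp [hτ, exitTime]
  · rw [← two_pow_sub_mul_half_pow hbm, ← add_mul]
    gcongr
    exact_mod_cast (not_le.1 (h i)).le
  · rintro i _ ⟨k, rfl⟩ _ ⟨k', rfl⟩ hs hs' hsT -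
    have mem : ∀ k : ℕ, (k : ℝ≥0) * (1 / 2) ^ m ∈
        Set.Ico ((τ i : ℝ≥0) * (1 / 2) ^ m) ((τ (i + 1) : ℝ≥0) * (1 / 2) ^ m) →
        τ i ≤ k ∧ k < τ (i + 1) := fun k hk =>
      ⟨by exact_mod_cast le_of_mul_le_mul_right hk.1 hp,
        by exact_mod_cast lt_of_mul_lt_mul_right hk.2 hp.le⟩
    have hkT : k < T * 2 ^ m := by
      have h1 : (T : ℝ≥0) = (T * 2 ^ m : ℕ) * (1 / 2) ^ m := by
        push_cast
        rw [mul_assoc, ← mul_pow]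
        norm_num
      simp only at hsT
      rw [h1] at hsT
      exact_mod_cast lt_of_mul_lt_mul_right hsT hp.le
    obtain ⟨h1, h2⟩ := mem k hs
    obtain ⟨h3, h4⟩ := mem k' hs'
    have e1 := abs_sub_lt_of_lt_nextExit (M := 2 ^ m)
      (y := fun k : ℕ => x (k * (1 / 2) ^ m)) hε (h1.trans hkT.le) h1 h2
    have e2 := abs_sub_lt_of_lt_nextExit (M := 2 ^ m)
      (y := fun k : ℕ => x (k * (1 / 2) ^ m)) hε (h1.trans hkT.le) h3 h4
    rw [abs_lt] at e1 e2
    rw [abs_le]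
    constructor <;> linarith [e1.1, e1.2, e2.1, e2.2]

theorem measure_not_hasPartitionOn_le (hY : ∀ t, Measurable[F t] (Y t))
    (hrc : ∀ ω t, ContinuousWithinAt (fun s => Y s ω) (Set.Ici t) t) (hε : 0 < ε) {T : ℕ}
    (hT : 0 < T) {a b : ℕ} (ha : 1 ≤ a) (hab : a ≤ b) {Z₀ Z₁ : Ω → ℝ≥0∞}
    (hZ₀ : ∀ t ≤ (T + 1 : ℝ≥0), ∀ u ≤ (2 * (1 / 2) ^ a : ℝ≥0), ∀ A, MeasurableSet[F t] A →
      ∫⁻ ω in A, ENNReal.ofReal ((Y (t + u) ω - Y t ω) ^ 2) ∂μ ≤ ∫⁻ ω in A, Z₀ ω ∂μ)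
    (hZ₁ : ∀ t ≤ (T + 1 : ℝ≥0), ∀ u ≤ (2 * (1 / 2) ^ b : ℝ≥0), ∀ A, MeasurableSet[F t] A →
      ∫⁻ ω in A, ENNReal.ofReal ((Y (t + u) ω - Y t ω) ^ 2) ∂μ ≤ ∫⁻ ω in A, Z₁ ω ∂μ) :
    ENNReal.ofReal (ε ^ 2) *
        μ {ω | ¬ HasPartitionOn Set.univ (fun t => Y t ω) T ((1 / 2) ^ b) (2 * ε)} ≤
      8 * ∫⁻ ω, Z₀ ω ∂μ + (T * 2 ^ (a + 1) : ℕ) * (4 * ∫⁻ ω, Z₁ ω ∂μ) := by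
  let bad : ℕ → Set Ω := fun m => ⋃ i, shortExit ε (T * 2 ^ m) (2 ^ m)
    (fun k ω => Y (k * (1 / 2) ^ m) ω) (2 ^ (m - b)) i
  have hgrid : ∀ m, b ≤ m → ENNReal.ofReal (ε ^ 2) * μ (bad m) ≤
      8 * ∫⁻ ω, Z₀ ω ∂μ + (T * 2 ^ (a + 1) : ℕ) * (4 * ∫⁻ ω, Z₁ ω ∂μ) := by
    intro m hm
    let G : Filtration ℕ m0 :=
      { seq := fun k => F (k * (1 / 2) ^ m)
        mono' := fun k l hkl => F.mono (by gcongr)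
        le' := fun k => F.le _ }
    have conv : ∀ (c : ℕ) (Z : Ω → ℝ≥0∞), c ≤ m →
        (∀ t ≤ (T + 1 : ℝ≥0), ∀ u ≤ (2 * (1 / 2) ^ c : ℝ≥0), ∀ A, MeasurableSet[F t] A →
          ∫⁻ ω in A, ENNReal.ofReal ((Y (t + u) ω - Y t ω) ^ 2) ∂μ ≤ ∫⁻ ω in A, Z ω ∂μ) →
        ∀ k l, k ≤ T * 2 ^ m + 2 ^ (m - c) → k ≤ l → l ≤ k + 2 * 2 ^ (m - c) →
          ∀ A, MeasurableSet[G k] A →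
          ∫⁻ ω in A, ENNReal.ofReal ((Y (l * (1 / 2) ^ m) ω - Y (k * (1 / 2) ^ m) ω) ^ 2) ∂μ ≤
            ∫⁻ ω in A, Z ω ∂μ := by
      intro c Z hc hZ k l hk hkl hl A hA
      obtain ⟨r, rfl⟩ := Nat.exists_eq_add_of_le hkl
      have h1 : ((k + r : ℕ) : ℝ≥0) * (1 / 2) ^ m = k * (1 / 2) ^ m + r * (1 / 2) ^ m := by
        push_cast
        ring
      rw [h1]
      refine hZ _ ?_ _ ?_ A hA
      · calc (k : ℝ≥0) * (1 / 2) ^ m ≤ ((T * 2 ^ m + 2 ^ (m - c) : ℕ) : ℝ≥0) * (1 / 2) ^ m := by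
              gcongr
          _ = T + (1 / 2) ^ c := by
              rw [← two_pow_sub_mul_half_pow hc]
              push_cast
              rw [add_mul, mul_assoc, ← mul_pow]
              norm_num
          _ ≤ T + 1 := by
              gcongr
              exact pow_le_one₀ zero_le (NNReal.half_lt_self one_ne_zero).le
      · have h2 : r ≤ 2 * 2 ^ (m - c) := by omega
        calc (r : ℝ≥0) * (1 / 2) ^ m ≤ ((2 * 2 ^ (m - c) : ℕ) : ℝ≥0) * (1 / 2) ^ m := by gcongr
          _ = 2 * (1 / 2) ^ c := by
              rw [← two_pow_sub_mul_half_pow hc]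
              push_cast
              ring
    -- In grid units N = T 2^m, M = 2^m, d₀ = 2^(m-a), d₁ = 2^(m-b), so q = T 2^(a+1) does not
    -- depend on m. The condition d₀ < M is where 1 ≤ a enters.
    refine measure_iUnion_shortExit_le (G := G) (fun k => hY _) (d₀ := 2 ^ (m - a)) ?_ ?_
      (by positivity) ?_ (by positivity) hε (conv a Z₀ (hab.trans hm) hZ₀) (conv b Z₁ hm hZ₁)
    · exact Nat.pow_lt_pow_right (by norm_num) (by omega)
    · exact Nat.pow_le_pow_right (by norm_num) (by omega)
    · rw [mul_assoc, ← pow_add, show a + 1 + (m - a) = m + 1 by omega, pow_succ]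
      ring
  -- Partitions on arbitrarily fine grids would give one on all times, so a path without a partition
  -- is bad on every sufficiently fine grid; the lower limit of the events obeys the same uniform
  -- bound.
  have hsub : {ω | ¬ HasPartitionOn Set.univ (fun t => Y t ω) T ((1 / 2) ^ b) (2 * ε)} ⊆
      ⋃ n, ⋂ m ≥ n, bad m := by
    intro ω hω
    have h1 : ∀ᶠ m in atTop, ω ∈ bad m := by
      by_contra hcon
      refine hω (hasPartitionOn_univ_of_frequently (hrc ω) dyadicGrid dyadicGrid_mono
        dense_iUnion_dyadicGrid ((not_eventually.1 hcon).mp ?_))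
      filter_upwards [eventually_ge_atTop b] with m hm hnot
      refine hasPartitionOn_dyadicGrid hε T hm fun i hi => hnot (Set.mem_iUnion.2 ⟨i, hi⟩)
    obtain ⟨n, hn⟩ := eventually_atTop.1 h1
    exact Set.mem_iUnion.2 ⟨n, Set.mem_iInter₂.2 hn⟩
  have hmono : Monotone fun n => ⋂ m ≥ n, bad m := fun n n' hnn =>
    Set.biInter_subset_biInter_left fun m hm => le_trans hnn hm
  refine (mul_le_mul_right (measure_mono hsub) _).trans ?_
  rw [hmono.measure_iUnion, ENNReal.mul_iSup]
  refine iSup_le fun n => le_trans ?_ (hgrid (max n b) (le_max_right _ _))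
  gcongr
  exact Set.biInter_subset_of_mem (le_max_left n b)

end Sampling

/-! ### From conditional bounds to integrals over events -/

section ConditionalExpectation

variable {Ω : Type*} {m m0 : MeasurableSpace Ω} {μ : Measure Ω}

/-- Integrated over events of the past, the conditional bound can be summed over the values of a
stopping time. -/
theorem setLIntegral_le_of_condLExp_le [IsFiniteMeasure μ] (hm : m ≤ m0)
    {f g : Ω → ℝ≥0∞} (h : ∀ᵐ ω ∂μ, (μ⁻[f|m]) ω ≤ (μ⁻[g|m]) ω) {A : Set Ω}
    (hA : MeasurableSet[m] A) : ∫⁻ ω in A, f ω ∂μ ≤ ∫⁻ ω in A, g ω ∂μ := by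
  rw [← setLIntegral_condLExp hm μ f hA, ← setLIntegral_condLExp hm μ g hA]
  exact lintegral_mono_ae (ae_restrict_of_ae h)

/-- The conditional second moment of an increment, in terms of the conditional expectations of the
increment and of the increment of the squares. -/
theorem setLIntegral_sq_sub_le [IsFiniteMeasure μ] (hm : m ≤ m0)
    {V W : Ω → ℝ} (hV : Measurable[m] V) (hW : Measurable W) {c : ℝ} (hVc : ∀ ω, |V ω| ≤ c)
    (hWc : ∀ ω, |W ω| ≤ c) {Z₁ Z₂ : Ω → ℝ≥0∞} (hZ₁m : Measurable Z₁)
    (hZ₁ : ∀ᵐ ω ∂μ, ENNReal.ofReal |(μ[fun ω => W ω - V ω | m]) ω| ≤ (μ⁻[Z₁|m]) ω)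
    (hZ₂ : ∀ᵐ ω ∂μ, ENNReal.ofReal |(μ[fun ω => W ω ^ 2 - V ω ^ 2 | m]) ω| ≤ (μ⁻[Z₂|m]) ω)
    {A : Set Ω} (hA : MeasurableSet[m] A) :
    ∫⁻ ω in A, ENNReal.ofReal ((W ω - V ω) ^ 2) ∂μ ≤
      ∫⁻ ω in A, (Z₂ ω + ENNReal.ofReal (2 * c) * Z₁ ω) ∂μ := by
  have hV0 : Measurable V := hV.mono hm le_rfl
  have bi : ∀ {f : Ω → ℝ} (C : ℝ), Measurable f → (∀ ω, |f ω| ≤ C) → Integrable f μ :=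
    fun C hf hC => .of_bound hf.aestronglyMeasurable C (ae_of_all _ hC)
  have hc2 : ∀ ω, |W ω - V ω| ≤ 2 * c := fun ω => by
    linarith [abs_sub (W ω) (V ω), hVc ω, hWc ω]
  have hd : Integrable (fun ω => W ω - V ω) μ := bi (2 * c) (hW.sub hV0) hc2
  have hVi : Integrable (fun ω => V ω * (W ω - V ω)) μ := by
    refine bi (c * (2 * c)) (hV0.mul (hW.sub hV0)) fun ω => ?_
    rw [abs_mul]
    exact mul_le_mul (hVc ω) (hc2 ω) (abs_nonneg _) ((abs_nonneg _).trans (hVc ω))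
  have sqi : ∀ {f : Ω → ℝ}, Measurable f → (∀ ω, |f ω| ≤ c) → Integrable (fun ω => f ω ^ 2) μ :=
    fun hf hC => bi (c ^ 2) (hf.pow_const 2) fun ω => by
      rw [abs_pow]
      exact pow_le_pow_left₀ (abs_nonneg _) (hC ω) 2
  have hsq : Integrable (fun ω => W ω ^ 2 - V ω ^ 2) μ := (sqi hW hWc).sub (sqi hV0 hVc)
  -- V is known at the earlier time, so it leaves the conditional expectation of V (W - V) as a
  -- factor bounded by c.
  have hdec : (fun ω => (W ω - V ω) ^ 2) =
      (fun ω => W ω ^ 2 - V ω ^ 2) - (2 : ℝ) • (V * fun ω => W ω - V ω) := by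
    ext ω
    simp only [Pi.sub_apply, Pi.smul_apply, Pi.mul_apply, smul_eq_mul]
    ring
  have hint : Integrable (fun ω => (W ω - V ω) ^ 2) μ := by
    rw [hdec]
    exact hsq.sub (hVi.smul (2 : ℝ))
  have hcond : ∀ᵐ ω ∂μ, (μ⁻[fun ω => ENNReal.ofReal ((W ω - V ω) ^ 2)|m]) ω ≤
      (μ⁻[Z₂|m]) ω + ENNReal.ofReal (2 * c) * (μ⁻[Z₁|m]) ω := by
    have e1 := condExp_sub (μ := μ) hsq (hVi.smul (2 : ℝ)) m
    have e2 := condExp_smul (μ := μ) (2 : ℝ) (V * fun ω => W ω - V ω) m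
    have e3 := condExp_mul_of_stronglyMeasurable_left (μ := μ) (g := fun ω => W ω - V ω)
      hV.stronglyMeasurable hVi hd
    have e4 := condLExp_ofReal m hint (ae_of_all _ fun ω => sq_nonneg _)
    filter_upwards [e1, e2, e3, e4, hZ₁, hZ₂] with ω h1 h2 h3 h4 h5 h6
    have hval : (μ[fun ω => (W ω - V ω) ^ 2|m]) ω =
        (μ[fun ω => W ω ^ 2 - V ω ^ 2|m]) ω - 2 * (V ω * (μ[fun ω => W ω - V ω|m]) ω) := by
      rw [hdec]
      refine h1.trans ?_
      rw [Pi.sub_apply]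
      congr 1
      refine h2.trans ?_
      rw [Pi.smul_apply, h3, Pi.mul_apply, smul_eq_mul]
    rw [h4, hval]
    have hc : 0 ≤ 2 * c := (abs_nonneg _).trans (hc2 ω)
    refine le_trans ?_ (add_le_add h6 (mul_le_mul_right h5 _))
    rw [← ENNReal.ofReal_mul hc, ← ENNReal.ofReal_add (abs_nonneg _) (by positivity)]
    apply ENNReal.ofReal_le_ofReal
    have k1 := le_abs_self ((μ[fun ω => W ω ^ 2 - V ω ^ 2|m]) ω)
    have k2 := neg_abs_le (V ω * (μ[fun ω => W ω - V ω|m]) ω)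
    rw [abs_mul] at k2
    have k3 := mul_le_mul_of_nonneg_right (hVc ω) (abs_nonneg ((μ[fun ω => W ω - V ω|m]) ω))
    linarith
  calc ∫⁻ ω in A, ENNReal.ofReal ((W ω - V ω) ^ 2) ∂μ
      = ∫⁻ ω in A, (μ⁻[fun ω => ENNReal.ofReal ((W ω - V ω) ^ 2)|m]) ω ∂μ :=
        (setLIntegral_condLExp hm μ _ hA).symm
    _ ≤ ∫⁻ ω in A, ((μ⁻[Z₂|m]) ω + ENNReal.ofReal (2 * c) * (μ⁻[Z₁|m]) ω) ∂μ :=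
        lintegral_mono_ae (ae_restrict_of_ae hcond)
    _ = ∫⁻ ω in A, (Z₂ ω + ENNReal.ofReal (2 * c) * Z₁ ω) ∂μ := by
        rw [lintegral_add_left (measurable_condLExp' m μ Z₂),
          lintegral_const_mul _ (measurable_condLExp' m μ Z₁),
          lintegral_add_right _ (hZ₁m.const_mul _), lintegral_const_mul _ hZ₁m,
          setLIntegral_condLExp hm μ _ hA, setLIntegral_condLExp hm μ _ hA]

end ConditionalExpectation

/-! ### Measurability, and a single random path -/

namespace SkorokhodD

/-- Right-continuity controls x s by later times of D before T. No such times exist for s = T, which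
is therefore adjoined to D. -/
theorem forall_abs_le_iff_of_dense (x : SkorokhodD) (T : ℝ≥0) {D : Set ℝ≥0} (hD : Dense D) (c : ℝ) :
    (∀ s ≤ T, |x s| ≤ c) ↔ ∀ s ∈ insert T D, s ≤ T → |x s| ≤ c := by
  refine ⟨fun h s _ hs => h s hs, fun h s hs => ?_⟩
  rcases eq_or_lt_of_le hs with rfl | hlt
  · exact h s (Set.mem_insert _ _) le_rfl
  have := hD.nhdsWithin_inter_Ioo_neBot hlt
  have ht : Tendsto x.toFun (𝓝[D ∩ Set.Ioo s T] s) (𝓝 (x s)) :=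
    (x.right_continuous s).mono_left (nhdsWithin_mono _ fun u hu => hu.2.1.le)
  refine le_of_tendsto ht.abs ?_
  filter_upwards [self_mem_nhdsWithin] with u hu
  exact h u (Set.mem_insert_of_mem _ hu.1) hu.2.2.le

theorem supNorm_le_iff (x : SkorokhodD) (T : ℝ≥0) (c : ℝ) :
    x.supNorm T ≤ c ↔ ∀ s ≤ T, |x s| ≤ c := by
  have : Nonempty (Set.Icc (0 : ℝ≥0) T) := ⟨⟨0, le_rfl, zero_le⟩⟩
  unfold supNorm
  rw [ciSup_le_iff (x.bddAbove_abs T)]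
  exact ⟨fun h s hs => h ⟨s, zero_le, hs⟩, fun h s => h s s.2.2⟩

theorem measurable_supNorm {Ω : Type*} [MeasurableSpace Ω] {X : Ω → SkorokhodD}
    (hX : ∀ t, Measurable fun ω => X ω t) (T : ℝ≥0) : Measurable fun ω => (X ω).supNorm T := by
  obtain ⟨D, hDc, hD⟩ := TopologicalSpace.exists_countable_dense ℝ≥0
  refine measurable_of_Iic fun c => ?_
  have : (fun ω => (X ω).supNorm T) ⁻¹' Set.Iic c =
      ⋂ s ∈ insert T D, {ω | s ≤ T → |X ω s| ≤ c} := by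
    ext ω
    simp only [Set.mem_preimage, Set.mem_Iic, supNorm_le_iff,
      forall_abs_le_iff_of_dense _ T hD, Set.mem_iInter, Set.mem_ofPred_eq]
  rw [this]
  refine MeasurableSet.biInter (hDc.insert T) fun s _ => ?_
  by_cases hs : s ≤ T
  · simp only [hs, true_imp_iff]
    exact measurableSet_le (measurable_norm.comp (hX s)) measurable_const
  · simp [hs]

/-- A single random element of `D` has partitions with high probability. -/
theorem exists_measure_not_hasPartitionOn_le {Ω : Type*} [MeasurableSpace Ω] {μ : Measure Ω}
    [IsFiniteMeasure μ] {X : Ω → SkorokhodD} (hX : Measurable X) (T : ℝ≥0) {ε : ℝ} (hε : 0 < ε)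
    {η : ℝ≥0∞} (hη : 0 < η) :
    ∃ δ > 0, μ {ω | ¬ HasPartitionOn Set.univ (X ω) T δ ε} ≤ η := by
  obtain ⟨e, he0, he1, heε⟩ : ∃ e : ℝ≥0, 0 < e ∧ e ≤ 1 ∧ (e : ℝ) ≤ ε / 2 := by
    refine ⟨min 1 (ε / 2).toNNReal, lt_min one_pos (by simpa using hε), min_le_left _ _, ?_⟩
    calc ((min 1 (ε / 2).toNNReal : ℝ≥0) : ℝ) ≤ ((ε / 2).toNNReal : ℝ) := by
          exact_mod_cast min_le_right _ _
      _ = ε / 2 := Real.coe_toNNReal _ (by positivity)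
  let d : ℕ → ℝ≥0 := fun k => e * (1 / 2) ^ k
  have hd0 : ∀ k, 0 < d k := fun k => by positivity
  have hhalf : (1 / 2 : ℝ≥0) < 1 := NNReal.half_lt_self one_ne_zero
  have hde : ∀ k, d k ≤ e := fun k => mul_le_of_le_one_right zero_le (pow_le_one₀ zero_le hhalf.le)
  have hda : Antitone d := fun k l hkl => by
    have := pow_le_pow_of_le_one (zero_le (a := (1 / 2 : ℝ≥0))) hhalf.le hkl
    exact mul_le_mul_right this _
  -- These closed sets increase to all of `D`, because each path has some partition. Continuity of
  -- the measure from above then makes the complement small.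
  let A : ℕ → Set SkorokhodD := fun k =>
    closure {x | HasPartitionOn Set.univ x (T + d k) (d k) (ε / 2)}
  have hA : Monotone A := fun k l hkl => closure_mono fun x hx =>
    HasPartitionOn.mono hx (by gcongr; exact hda hkl) (hda hkl) le_rfl
  have hAuniv : ∀ x, ∃ k, x ∈ A k := by
    intro x
    obtain ⟨δ, hδ, hx⟩ := exists_hasPartitionOn x.right_continuous x.left_limit (T + 1)
      (half_pos hε)
    obtain ⟨k, hk⟩ := exists_pow_lt_of_lt_one hδ hhalf
    have h1 : d k ≤ (1 / 2) ^ k := mul_le_of_le_one_left zero_le he1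
    exact ⟨k, subset_closure (hx.mono (by gcongr; exact (hde k).trans he1) (h1.trans hk.le) le_rfl)⟩
  have hlim : Tendsto (fun k => μ (X ⁻¹' (A k)ᶜ)) atTop (𝓝 0) := by
    have h0 : ⋂ k, X ⁻¹' (A k)ᶜ = ∅ := by
      refine Set.eq_empty_of_forall_notMem fun ω hω => ?_
      obtain ⟨k, hk⟩ := hAuniv (X ω)
      exact Set.mem_iInter.1 hω k hk
    rw [← measure_empty (μ := μ), ← h0]
    refine tendsto_measure_iInter_atTop
      (fun k => (hX isClosed_closure.measurableSet.compl).nullMeasurableSet) ?_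
      ⟨0, measure_ne_top _ _⟩
    exact fun k l hkl => Set.preimage_mono (Set.compl_subset_compl.2 (hA hkl))
  obtain ⟨k, hk⟩ := (hlim.eventually_le_const hη).exists
  refine ⟨d k / 3, by have := hd0 k; positivity, (measure_mono ?_).trans hk⟩
  intro ω hω hωA
  refine hω (closure_hasPartitionOn_subset (hd0 k) ?_ hωA)
  have : ((d k : ℝ≥0) : ℝ) ≤ e := by exact_mod_cast hde k
  have h0 : (0 : ℝ) ≤ d k := (d k).2
  push_cast
  linarith

end SkorokhodD

theorem limsup_add_le_add_limsup {α : Type*} {l : Filter α} (u v : α → ℝ≥0∞) :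
    limsup (u + v) l ≤ limsup u l + limsup v l := by
  refine ENNReal.le_of_forall_pos_le_add fun e he hlt => ?_
  obtain ⟨hu, hv⟩ := ENNReal.add_lt_top.1 hlt
  have he2 : (e / 2 : ℝ≥0∞) ≠ 0 := (ENNReal.half_pos (by exact_mod_cast he.ne')).ne'
  refine limsup_le_of_le (h := ?_)
  filter_upwards [eventually_lt_of_limsup_lt (ENNReal.lt_add_right hu.ne he2),
    eventually_lt_of_limsup_lt (ENNReal.lt_add_right hv.ne he2)] with a hau hav
  refine (add_le_add hau.le hav.le).trans_eq ?_
  rw [add_add_add_comm, ENNReal.add_halves]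

/-! ### Tightness of sequences -/

section Sequences

variable {Ω : ℕ → Type*} [mΩ : ∀ n, MeasurableSpace (Ω n)] {P : ∀ n, Measure (Ω n)}
  {X : ∀ n, Ω n → SkorokhodD}

theorem exists_eventually_measure_not_hasPartitionOn_le {F : ∀ n, Filtration ℝ≥0 (mΩ n)}
    {Y : ∀ n, ℝ≥0 → Ω n → ℝ} (hY : ∀ n t, Measurable[F n t] (Y n t))
    (hrc : ∀ n ω t, ContinuousWithinAt (fun s => Y n s ω) (Set.Ici t) t) {T : ℕ} (hT : 0 < T)
    {Z : ∀ n, ℝ≥0 → Ω n → ℝ≥0∞}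
    (hZ : ∀ n, ∀ δ > 0, ∀ t ≤ (T + 1 : ℝ≥0), ∀ u ≤ δ, ∀ A, MeasurableSet[F n t] A →
      ∫⁻ ω in A, ENNReal.ofReal ((Y n (t + u) ω - Y n t ω) ^ 2) ∂(P n) ≤
        ∫⁻ ω in A, Z n δ ω ∂(P n))
    (hlim : Tendsto (fun δ : ℝ≥0 => limsup (fun n => ∫⁻ ω, Z n δ ω ∂(P n)) atTop)
      (𝓝[>] 0) (𝓝 0)) {ε : ℝ} (hε : 0 < ε) {η : ℝ≥0∞} (hη : 0 < η) :
    ∃ δ > 0, ∀ᶠ n in atTop,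
      P n {ω | ¬ HasPartitionOn Set.univ (fun t => Y n t ω) T δ ε} ≤ η := by
  have hscale : Tendsto (fun a : ℕ => (2 * (1 / 2) ^ a : ℝ≥0)) atTop (𝓝[>] 0) := by
    refine tendsto_nhdsWithin_iff.2 ⟨?_, Eventually.of_forall fun a => ?_⟩
    · have := (NNReal.tendsto_pow_atTop_nhds_zero_of_lt_one
        (NNReal.half_lt_self one_ne_zero : (1 / 2 : ℝ≥0) < 1)).const_mul 2
      rwa [mul_zero] at this
    · exact Set.mem_Ioi.2 (by positivity)
  have small : ∀ c : ℝ≥0∞, 0 < c → ∀ a₀ : ℕ, ∃ a ≥ a₀, ∀ᶠ n in atTop,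
      ∫⁻ ω, Z n (2 * (1 / 2) ^ a) ω ∂(P n) ≤ c := by
    intro c hc a₀
    obtain ⟨a, ha, ha'⟩ := (((hlim.comp hscale).eventually_lt_const hc).and
      (eventually_ge_atTop a₀)).exists
    exact ⟨a, ha', (eventually_lt_of_limsup_lt ha).mono fun n hn => hn.le⟩
  set c : ℝ≥0∞ := ENNReal.ofReal ((ε / 2) ^ 2) with hc
  have hc0 : c ≠ 0 := (ENNReal.ofReal_pos.2 (by positivity)).ne'
  have hcη : 0 < c * η / 2 := ENNReal.div_pos (mul_ne_zero hc0 hη.ne') (by norm_num)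
  -- The coarse scale a is chosen first; it fixes the number T 2^(a+1) of exits that the fine scale
  -- b has to beat. Each contributes half of c η, where c = (ε/2)² because exits at distance ε/2
  -- give oscillation ε.
  obtain ⟨a, ha, hZa⟩ := small (c * η / 2 / 8) (ENNReal.div_pos hcη.ne' (by norm_num)) 1
  obtain ⟨b, hb, hZb⟩ := small (c * η / 2 / ((T * 2 ^ (a + 1) : ℕ) * 4))
    (ENNReal.div_pos hcη.ne' (ENNReal.mul_ne_top (ENNReal.natCast_ne_top _) (by norm_num))) a
  refine ⟨(1 / 2) ^ b, by positivity, ?_⟩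
  filter_upwards [hZa, hZb] with n hna hnb
  have h := measure_not_hasPartitionOn_le (μ := P n) (hY n) (hrc n) (half_pos hε) hT ha hb
    (hZ n _ (by positivity)) (hZ n _ (by positivity))
  rw [mul_div_cancel₀ _ (two_ne_zero' ℝ), ← hc] at h
  rw [← ENNReal.mul_le_mul_iff_right hc0 ENNReal.ofReal_ne_top]
  refine h.trans ?_
  rw [← ENNReal.add_halves (c * η), ← mul_assoc]
  gcongr
  · rw [mul_comm]
    exact ENNReal.mul_le_of_le_div hna
  · rw [mul_comm]
    exact ENNReal.mul_le_of_le_div hnb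

/-- The finitely many exceptional n are absorbed in a minimum of their own δ, so control of the
upper limit in n is enough. -/
theorem exists_forall_le_of_eventually {p : ℝ≥0 → ℕ → Prop}
    (hp : ∀ n δ δ', δ' ≤ δ → p δ n → p δ' n) (hn : ∀ n, ∃ δ > 0, p δ n)
    (h : ∃ δ > 0, ∀ᶠ n in atTop, p δ n) : ∃ δ > 0, ∀ n, p δ n := by
  obtain ⟨δ₀, hδ₀, h⟩ := h
  obtain ⟨N, hN⟩ := eventually_atTop.1 h
  choose d hd hdp using hn
  have key : ∀ N : ℕ, ∃ δ > 0, ∀ n < N, p δ n := by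
    intro N
    induction N with
    | zero => exact ⟨1, one_pos, fun n hn => absurd hn (Nat.not_lt_zero n)⟩
    | succ N ih =>
      obtain ⟨δ, hδ, h⟩ := ih
      refine ⟨min δ (d N), lt_min hδ (hd N), fun n hn => ?_⟩
      rcases Nat.lt_succ_iff_lt_or_eq.1 hn with hlt | rfl
      · exact hp n _ _ (min_le_left _ _) (h n hlt)
      · exact hp n _ _ (min_le_right _ _) (hdp n)
  obtain ⟨δ, hδ, hlt⟩ := key N
  refine ⟨min δ δ₀, lt_min hδ hδ₀, fun n => ?_⟩
  rcases lt_or_ge n N with hnN | hnN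
  · exact hp n _ _ (min_le_left _ _) (hlt n hnN)
  · exact hp n _ _ (min_le_right _ _) (hN n hnN)

theorem StochasticallyBoundedInD.exists_forall_measure_le (h : StochasticallyBoundedInD P X)
    (hX : ∀ n t, Measurable fun ω => X n ω t) (T : ℝ≥0) {η : ℝ≥0∞} (hη : 0 < η) :
    ∃ C : ℝ, ∀ n, P n {ω | ¬ ∀ s ≤ T, |X n ω s| ≤ C} ≤ η := by
  -- Stochastic boundedness concerns positive horizons, and T may be 0.
  obtain ⟨K, hK, hKP⟩ := isTightMeasureSet_iff_exists_isCompact_measure_compl_le.1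
    (h (T + 1) (by positivity)) η hη
  obtain ⟨C, hC⟩ := hK.bddAbove
  refine ⟨C, fun n => (measure_mono (Set.compl_subset_compl.2 fun ω hω => ?_)).trans
    ((Measure.map_apply (SkorokhodD.measurable_supNorm (hX n) _)
      hK.isClosed.measurableSet.compl).symm.trans_le (hKP _ ⟨n, rfl⟩))⟩
  exact fun s hs => (SkorokhodD.supNorm_le_iff _ _ _).1 (hC hω) s (hs.trans le_self_add)

/-- Tightness in `D` from bounds and partitions that hold with high probability. -/
theorem tightSequence_of_bounded_of_hasPartitionOn (hX : ∀ n, Measurable (X n))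
    (hb : ∀ j : ℕ, ∀ η : ℝ≥0∞, 0 < η → ∃ C : ℝ, ∀ n, P n {ω | ¬ ∀ s ≤ (j : ℝ≥0), |X n ω s| ≤ C} ≤ η)
    (hp : ∀ j : ℕ, ∀ ε : ℝ, 0 < ε → ∀ η : ℝ≥0∞, 0 < η → ∃ δ > 0, ∀ n,
      P n {ω | ¬ HasPartitionOn Set.univ (X n ω) j δ ε} ≤ η) : TightSequence P X := by
  refine isTightMeasureSet_iff_exists_isCompact_measure_compl_le.2 fun η hη => ?_
  obtain ⟨e, he, hsum⟩ := ENNReal.exists_pos_sum_of_countable' hη.ne' ℕ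
  have he2 : ∀ j, 0 < e j / 2 := fun j => ENNReal.half_pos (he j).ne'
  choose C hC using fun j => hb j _ (he2 j)
  choose δ hδ hδP using fun j : ℕ => hp j (1 / ((j : ℝ) + 1)) (by positivity) _ (he2 j)
  refine ⟨closure (SkorokhodD.boundedPartitioned C δ),
    SkorokhodD.isCompact_closure_boundedPartitioned hδ, ?_⟩
  rintro _ ⟨n, rfl⟩
  rw [Measure.map_apply (hX n) isClosed_closure.measurableSet.compl]
  calc P n (X n ⁻¹' (closure (SkorokhodD.boundedPartitioned C δ))ᶜ)
      ≤ P n (⋃ j : ℕ, {ω | ¬ ∀ s ≤ (j : ℝ≥0), |X n ω s| ≤ C j} ∪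
          {ω | ¬ HasPartitionOn Set.univ (X n ω) j (δ j) (1 / ((j : ℝ) + 1))}) := by
        refine measure_mono fun ω hω => ?_
        by_contra hcon
        refine hω (subset_closure fun j => ?_)
        have := fun h => hcon (Set.mem_iUnion.2 ⟨j, h⟩)
        simpa [Set.mem_union, not_or] using this
    _ ≤ ∑' j, (e j / 2 + e j / 2) :=
        (measure_iUnion_le _).trans (ENNReal.tsum_le_tsum fun j =>
          (measure_union_le _ _).trans (add_le_add (hC j n) (hδP j n)))
    _ ≤ η := by
        simp only [ENNReal.add_halves]
        exact hsum.le

theorem not_tendsto_limsup_lintegral {Z : ∀ n, ℝ≥0 → Ω n → ℝ≥0}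
    (h : ∀ n, ∀ δ > 0, δ ≤ 1 → 1 ≤ ∫⁻ ω, (Z n δ ω : ℝ≥0∞) ∂(P n)) :
    ¬ Tendsto (fun δ : ℝ≥0 => limsup (fun n => ∫⁻ ω, (Z n δ ω : ℝ≥0∞) ∂(P n)) atTop)
      (𝓝[>] 0) (𝓝 0) := by
  intro hlim
  obtain ⟨δ, hδ, hδ1⟩ := ((hlim.eventually_lt_const one_pos).and
    (Ioc_mem_nhdsGT (one_pos : (0 : ℝ≥0) < 1))).exists
  refine not_le.2 hδ ?_
  refine le_limsup_of_frequently_le (Frequently.of_forall fun n => h n δ hδ1.1 hδ1.2)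

theorem tightSequence_const {S : Type*} [TopologicalSpace S] [R1Space S] [MeasurableSpace S]
    [BorelSpace S] (x : S) : TightSequence P fun _ _ => x := by
  refine isTightMeasureSet_iff_exists_isCompact_measure_compl_le.2 fun η _ =>
    ⟨closure {x}, isCompact_closure_singleton, ?_⟩
  rintro _ ⟨n, rfl⟩
  rw [Measure.map_apply measurable_const isClosed_closure.measurableSet.compl]
  simp [subset_closure (Set.mem_singleton x)]

variable [∀ n, IsProbabilityMeasure (P n)]

theorem SecondMomentCriterion.tightSequence (hX : ∀ n, Measurable (X n))
    (hb : StochasticallyBoundedInD P X) (h : SecondMomentCriterion P X) : TightSequence P X := by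
  obtain ⟨F, hF, h⟩ := h
  have hX' : ∀ n t, Measurable fun ω => X n ω t := fun n t => (hF n t).mono ((F n).le t) le_rfl
  refine tightSequence_of_bounded_of_hasPartitionOn hX
    (fun j η hη => hb.exists_forall_measure_le hX' j hη) fun j ε hε η hη => ?_
  refine exists_forall_le_of_eventually (fun n δ δ' hδ hle => (measure_mono ?_).trans hle)
    (fun n => SkorokhodD.exists_measure_not_hasPartitionOn_le (hX n) j hε hη) ?_
  · exact fun ω hω hω' => hω (hω'.mono le_rfl hδ le_rfl)
  -- The horizon j + 1 is positive even for j = 0. The further 1 covers exit times that overshoot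
  -- it.
  obtain ⟨Z, -, hZ, hlim⟩ := h ((j + 1 : ℕ) + 1) (by positivity)
  obtain ⟨δ, hδ, hev⟩ := exists_eventually_measure_not_hasPartitionOn_le (P := P) (F := F)
    (Y := fun n t ω => X n ω t) (Z := fun n δ ω => (Z n δ ω : ℝ≥0∞)) hF
    (fun n ω => (X n ω).right_continuous) (T := j + 1) (Nat.succ_pos j)
    (fun n δ hδ t ht u hu A hA =>
      setLIntegral_le_of_condLExp_le ((F n).le t) (hZ n δ hδ t ht u hu) hA) hlim hε hη
  refine ⟨δ, hδ, hev.mono fun n hn => (measure_mono (Set.compl_subset_compl.2 fun ω hω => ?_)).trans hn⟩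
  exact HasPartitionOn.mono hω (by exact_mod_cast Nat.le_succ j) le_rfl le_rfl

/-- A smooth bump times the identity: the composite with f is the path itself while the path stays
in [-C, C]. -/
theorem exists_contDiff_hasCompactSupport_eq_id (C : ℝ) :
    ∃ f : ℝ → ℝ, ContDiff ℝ ((⊤ : ℕ∞) : WithTop ℕ∞) f ∧ HasCompactSupport f ∧
      ∀ x, |x| ≤ C → f x = x := by
  have hC : 0 < |C| + 1 := by positivity
  let χ : ContDiffBump (0 : ℝ) := ⟨|C| + 1, |C| + 2, hC, by linarith⟩
  refine ⟨fun x => χ x * x, χ.contDiff.mul contDiff_id, χ.hasCompactSupport.mul_right,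
    fun x hx => ?_⟩
  beta_reduce
  rw [χ.one_of_mem_closedBall, one_mul]
  rw [Metric.mem_closedBall, dist_zero_right, Real.norm_eq_abs]
  change |x| ≤ |C| + 1
  linarith [le_abs_self C]

theorem TestFunctionCriterion.tightSequence (hX : ∀ n, Measurable (X n))
    (hb : StochasticallyBoundedInD P X) (h : TestFunctionCriterion P X) : TightSequence P X := by
  obtain ⟨F, hF, h⟩ := h
  have hX' : ∀ n t, Measurable fun ω => X n ω t := fun n t => (hF n t).mono ((F n).le t) le_rfl
  refine tightSequence_of_bounded_of_hasPartitionOn hX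
    (fun j η hη => hb.exists_forall_measure_le hX' j hη) fun j ε hε η hη => ?_
  refine exists_forall_le_of_eventually (fun n δ δ' hδ hle => (measure_mono ?_).trans hle)
    (fun n => SkorokhodD.exists_measure_not_hasPartitionOn_le (hX n) j hε hη) ?_
  · exact fun ω hω hω' => hω (hω'.mono le_rfl hδ le_rfl)
  have hη2 : 0 < η / 2 := ENNReal.half_pos hη.ne'
  obtain ⟨C, hC⟩ := hb.exists_forall_measure_le hX' j hη2
  obtain ⟨f, hf, hfc, hfC⟩ := exists_contDiff_hasCompactSupport_eq_id C
  obtain ⟨c, hc⟩ := hfc.exists_bound_of_continuous hf.continuous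
  have hfsq : HasCompactSupport fun x => f x ^ 2 := hfc.comp_left (g := fun y => y ^ 2) (by simp)
  have hT : (0 : ℝ≥0) < (j + 1 : ℕ) + 1 := by positivity
  -- Controls for f and f² combine to Z₂ + 2c Z₁, a second moment control for f(X), where c bounds
  -- |f|.
  obtain ⟨Z₁, hZ₁m, hZ₁, hlim₁⟩ := h f hf hfc _ hT
  obtain ⟨Z₂, hZ₂m, hZ₂, hlim₂⟩ := h (fun x => f x ^ 2) (hf.pow 2) hfsq _ hT
  have hlim : Tendsto (fun δ : ℝ≥0 => limsup (fun n =>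
      ∫⁻ ω, ((Z₂ n δ ω : ℝ≥0∞) + ENNReal.ofReal (2 * c) * Z₁ n δ ω) ∂(P n)) atTop)
      (𝓝[>] 0) (𝓝 0) := by
    have h1 := hlim₂.add (ENNReal.Tendsto.const_mul hlim₁
      (Or.inr (ENNReal.ofReal_ne_top (r := 2 * c))))
    rw [mul_zero, add_zero] at h1
    refine tendsto_of_tendsto_of_tendsto_of_le_of_le' tendsto_const_nhds h1
      (Eventually.of_forall fun _ => zero_le) ?_
    filter_upwards [self_mem_nhdsWithin] with δ hδ
    rw [← ENNReal.limsup_const_mul_of_ne_top ENNReal.ofReal_ne_top]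
    refine le_trans (le_of_eq ?_) (limsup_add_le_add_limsup _ _)
    congr 1
    ext n
    have hm := (hZ₁m n δ hδ).coe_nnreal_ennreal
    rw [lintegral_add_right _ (hm.const_mul _), lintegral_const_mul _ hm]
    rfl
  obtain ⟨δ, hδ, hev⟩ := exists_eventually_measure_not_hasPartitionOn_le (P := P) (F := F)
    (Y := fun n t ω => f (X n ω t))
    (Z := fun n δ ω => (Z₂ n δ ω : ℝ≥0∞) + ENNReal.ofReal (2 * c) * Z₁ n δ ω)
    (fun n t => hf.continuous.measurable.comp (hF n t))
    (fun n ω t => hf.continuous.continuousAt.comp_continuousWithinAt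
      ((X n ω).right_continuous t)) (T := j + 1) (Nat.succ_pos j)
    (fun n δ hδ t ht u hu A hA => setLIntegral_sq_sub_le ((F n).le t)
      (hf.continuous.measurable.comp (hF n t)) (hf.continuous.measurable.comp (hX' n (t + u)))
      (fun ω => hc _) (fun ω => hc _) (hZ₁m n δ hδ).coe_nnreal_ennreal
      (hZ₁ n δ hδ t ht u hu) (hZ₂ n δ hδ t ht u hu) hA) hlim hε hη2
  refine ⟨δ, hδ, hev.mono fun n hn => ?_⟩
  rw [← ENNReal.add_halves η]
  -- Outside the first event f(X) = X on [0, j], so a partition for f(X) is one for X.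
  refine (measure_mono (t := {ω | ¬ ∀ s ≤ (j : ℝ≥0), |X n ω s| ≤ C} ∪
    {ω | ¬ HasPartitionOn Set.univ (fun t => f (X n ω t)) (j + 1 : ℕ) δ ε}) ?_).trans
    ((measure_union_le _ _).trans (add_le_add (hC n) hn))
  intro ω hω
  by_contra hcon
  simp only [Set.mem_union, Set.mem_ofPred_eq, not_or, not_not] at hcon
  refine hω ((hcon.2.mono (by exact_mod_cast Nat.le_succ j) le_rfl le_rfl).congr fun s hs => ?_)
  exact hfC _ (hcon.1 s hs.le)

/-! ### The criteria are not necessary -/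

/-- The function that jumps from `0` to `1` at time `1`. -/
noncomputable def SkorokhodD.unitJump : SkorokhodD where
  toFun t := if 1 ≤ t then 1 else 0
  right_continuous t := by
    rcases le_or_gt 1 t with h | h
    · refine tendsto_const_nhds.congr' ?_
      filter_upwards [self_mem_nhdsWithin] with s hs
      simp [h, h.trans hs]
    · refine tendsto_const_nhds.congr' ?_
      filter_upwards [nhdsWithin_le_nhds (Iio_mem_nhds h)] with s hs
      simp [not_le.2 h, not_le.2 (Set.mem_Iio.1 hs)]
  left_limit t := by
    rcases le_or_gt t 1 with h | h
    · refine ⟨0, tendsto_const_nhds.congr' ?_⟩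
      filter_upwards [self_mem_nhdsWithin] with s hs
      simp [not_le.2 ((Set.mem_Iio.1 hs).trans_le h)]
    · refine ⟨1, tendsto_const_nhds.congr' ?_⟩
      filter_upwards [nhdsWithin_le_nhds (Ioi_mem_nhds h)] with s hs
      simp [(Set.mem_Ioi.1 hs).le]

theorem one_le_lintegral_of_one_le_condLExp {Ω : Type*} {m m0 : MeasurableSpace Ω} {μ : Measure Ω}
    [IsProbabilityMeasure μ] (hm : m ≤ m0) {Z : Ω → ℝ≥0∞} (h : ∀ᵐ ω ∂μ, 1 ≤ (μ⁻[Z|m]) ω) :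
    1 ≤ ∫⁻ ω, Z ω ∂μ := by
  rw [← lintegral_condLExp hm μ Z]
  calc (1 : ℝ≥0∞) = ∫⁻ _, 1 ∂μ := by simp
    _ ≤ _ := lintegral_mono_ae h

/-- The window of length δ that ends at the jump sees an increment of 1 for every δ. Being
deterministic, this increment equals its conditional expectation for any filtration. -/
theorem unitJump_one_sub {δ : ℝ≥0} (hδ : 0 < δ) (hδ1 : δ ≤ 1) :
    SkorokhodD.unitJump (1 - δ + δ) = 1 ∧ SkorokhodD.unitJump (1 - δ) = 0 := by
  rw [tsub_add_cancel_of_le hδ1]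
  have : 1 - δ < 1 := tsub_lt_self one_pos hδ
  exact ⟨if_pos le_rfl, if_neg (not_le.2 this)⟩

theorem not_secondMomentCriterion_unitJump :
    ¬ SecondMomentCriterion P fun _ _ => SkorokhodD.unitJump := by
  rintro ⟨F, -, h⟩
  obtain ⟨Z, -, hZ, hlim⟩ := h 1 one_pos
  refine not_tendsto_limsup_lintegral (fun n δ hδ hδ1 => ?_) hlim
  refine one_le_lintegral_of_one_le_condLExp ((F n).le (1 - δ)) ?_
  filter_upwards [hZ n δ hδ (1 - δ) tsub_le_self δ le_rfl] with ω hω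
  simpa [unitJump_one_sub hδ hδ1, condLExp_const ((F n).le (1 - δ))] using hω

theorem not_testFunctionCriterion_unitJump :
    ¬ TestFunctionCriterion P fun _ _ => SkorokhodD.unitJump := by
  rintro ⟨F, -, h⟩
  obtain ⟨f, hf, hfc, hf1⟩ := exists_contDiff_hasCompactSupport_eq_id 1
  obtain ⟨Z, -, hZ, hlim⟩ := h f hf hfc 1 one_pos
  refine not_tendsto_limsup_lintegral (fun n δ hδ hδ1 => ?_) hlim
  refine one_le_lintegral_of_one_le_condLExp ((F n).le (1 - δ)) ?_
  filter_upwards [hZ n δ hδ (1 - δ) tsub_le_self δ le_rfl] with ω hω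
  simpa [unitJump_one_sub hδ hδ1, condExp_const ((F n).le (1 - δ)), hf1 1 (by simp),
    hf1 0 (by simp)] using hω

end Sequences

theorem lemma3p9 {Ω : ℕ → Type*} [mΩ : ∀ n, MeasurableSpace (Ω n)]
    (P : ∀ n, Measure (Ω n)) [∀ n, IsProbabilityMeasure (P n)] :
    -- sufficiency
    (∀ X : ∀ n, Ω n → SkorokhodD, (∀ n, Measurable (X n)) →
      StochasticallyBoundedInD P X →
      (TestFunctionCriterion P X ∨ SecondMomentCriterion P X) →
      TightSequence P X) ∧
    -- the conditions are not necessary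
    (∃ X : ∀ n, Ω n → SkorokhodD, (∀ n, Measurable (X n)) ∧
      TightSequence P X ∧ ¬ TestFunctionCriterion P X ∧ ¬ SecondMomentCriterion P X) :=
  ⟨fun _ hX hb h => h.elim (fun h => h.tightSequence hX hb) fun h => h.tightSequence hX hb,
    fun _ _ => SkorokhodD.unitJump, fun _ => measurable_const, tightSequence_const _,
    not_testFunctionCriterion_unitJump, not_secondMomentCriterion_unitJump⟩
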